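/- **Setting.** Let $a\in\mathbb R$, $\alpha>1$, $1/\alpha+1/\beta=1$, $\Phi(u)=|u|^{\alpha-1}\operatorname{sgn}u$, so that $\Phi^{-1}(u)=|u|^{\beta-1}\operatorname{sgn}u$. Let $r,p:[a,\infty)\to(0,\infty)$ be continuous, and let $\tau:[a,\infty)\to\mathbb R$ be $C^1$ with $\tau'>0$, $\tau(t)\le t$, and $\limsup_{t\to\infty}t/\tau(t)<\infty$, where $\tau(t)>0$ for large $t$. Consider $$(r(t)\Phi(y'))'=p(t)\Phi(y(\tau(t))).\tag{E}$$ A solution of (E) on an interval $I\subseteq[a,\infty)$ is a $C^1$ function $y$ on $I$ with $r\Phi(y')\in C^1(I)$ that satisfies (E) at every $t\in I$ with $\tau(t)\in I$. Let $\mathcal S$ be the set of functions that are positive solutions of (E) for large $t$, that is, on some $[b,\infty)$ with $b\ge a$. Put $\mathcal{IS}=\{y\in\mathcal S: y'(t)>0\text{ for large }t\}$ and $y^{[1]}=r\Phi(y')$. Let $\mathcal{IS}_{\infty,\infty}$ be the set of $y\in\mathcal{IS}$ with $y\to\infty$ and $y^{[1]}\to\infty$, and $\mathcal{IS}_{B,\infty}$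 the set of $y\in\mathcal{IS}$ with $\lim y\in\mathbb R\setminus\{0\}$ and $y^{[1]}\to\infty$ (as $t\to\infty$). The following notions concern functions near infinity. $f\in\mathcal{RV}(\vartheta)$ means that $f$ is positive and measurable on some half-line and $f(\lambda t)/f(t)\to\lambda^\vartheta$ as $t\to\infty$ for every $\lambda>0$. In that case $L_f(t)=f(t)/t^\vartheta$. $\mathcal{SV}=\mathcal{RV}(0)$. $f\in\mathcal{NSV}$ means $f(t)=C\exp\int_{t_0}^t\frac{\psi(s)}s\,ds$ for $t\ge t_0$, for some $t_0,C>0$ and some measurable $\psi$ with $\psi(t)\to0$. $f\in\Pi(w)$ means that $f$ is measurable on some half-line, $w(t)>0$ for large $t$ and $(f(\lambda t)-f(t))/w(t)\to\ln\lambda$ as $t\to\infty$ for every $\lambda>0$. Put $\mathcal S_{\mathcal{SV}}=\mathcal S\cap\mathcal{SV}$, $\mathcal S_{\mathcal{NSV}}=\mathcal S\cap\mathcal{NSV}$ and $$G(t)=\Phi^{-1}\!\left(\frac{t\,p(t)}{r(t)}\right)\quad\Bigl(=\Bigl(\tfrac{t\,p(t)}{r(t)}\Bigr)^{\beta-1}\text{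 for }t\ge0\Bigr).$$ As usual, $f\sim g$ means $f/g\to1$ as $t\to\infty$, and $f=o(g)$ means $f/g\to0$ as $t\to\infty$. **Theorem.** (I) Assume $\int_a^\infty p(s)\,ds=\infty$ and $\lim_{t\to\infty}\frac{t^{\alpha-1}}{r(t)}\int_a^tp(s)\,ds=0$. Then $\mathcal{IS}\subset\mathcal{NSV}$. If, in addition, $p\in\mathcal{RV}(\delta)$ with $\delta>-1$, then the following hold. (i) If $\int_a^\infty G(s)\,ds=\infty$, then for every $y\in\mathcal{IS}$ there is a function $\varepsilon$ with $\varepsilon(t)\to0$ as $t\to\infty$ such that, for all large $t$, $$y(t)=\exp\left\{\int_a^t(1+\varepsilon(s))\frac{G(s)}{\Phi^{-1}(\delta+1)}\,ds\right\}.$$ Moreover, $\mathcal S_{\mathcal{NSV}}=\mathcal S_{\mathcal{SV}}=\mathcal{IS}=\mathcal{IS}_{\infty,\infty}$. (ii) If $\int_a^\infty G(s)\,ds<\infty$, then for every $y\in\mathcal{IS}$ the limit $N:=\lim_{t\to\infty}y(t)$ exists in $(0,\infty)$ and there is a function $\varepsilon$ with $\varepsilon(t)\to0$ as $t\to\infty$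 such that, for all large $t$, $$y(t)=N\exp\left\{-\int_t^\infty(1+\varepsilon(s))\frac{G(s)}{\Phi^{-1}(\delta+1)}\,ds\right\}.$$ Moreover, $\mathcal S_{\mathcal{NSV}}=\mathcal S_{\mathcal{SV}}=\mathcal{IS}=\mathcal{IS}_{B,\infty}$. (The integrands in (i) and (ii) are integrable over the ranges of integration.) (II) Let all the assumptions of (I) hold, including $p\in\mathcal{RV}(\delta)$ with $\delta>-1$, and let $r\in\mathcal{RV}(\gamma)$. Then $\gamma\ge\alpha+\delta$. If $\gamma=\alpha+\delta$, then $y\in\Pi(ty'(t))$ for every $y\in\mathcal{IS}$. If either $\gamma=\alpha+\delta$ and $\int_a^\infty G(s)\,ds<\infty$, or $\gamma>\alpha+\delta$, then $\int_a^\infty G(s)\,ds<\infty$ and for every $y\in\mathcal{IS}$ the limit $N:=\lim_{t\to\infty}y(t)$ exists in $(0,\infty)$ and $$N-y(t)\sim\frac{N}{\Phi^{-1}(\delta+1)}\int_t^\infty G(s)\,ds\in\mathcal{RV}\bigl((\delta+1-\gamma)(\beta-1)+1\bigr).$$ In particular, if here $\gamma=\alpha+\delta$, then moreover $|N-y|\in\mathcal{SV}$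 and $$\frac{L_p^{\beta-1}(t)}{L_r^{\beta-1}(t)\,(N-y(t))}=o(1)\quad\text{as }t\to\infty.$$ -/

import Mathlib

open Set Filter Topology MeasureTheory

noncomputable section

namespace HalfLinear

/-- The odd power `Φ(u) = |u|^(α-1) sgn u`. For the conjugate number `β` of `α`, the inverse
function `Φ⁻¹` is `Phi β`, see `Phi_conj` below. -/
def Phi (α u : ℝ) : ℝ := |u| ^ (α - 1) * Real.sign u

theorem Phi_conj {α β : ℝ} (hα : 1 < α) (h : 1 / α + 1 / β = 1) (u : ℝ) :
    Phi β (Phi α u) = u := by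
  have hα0 : α ≠ 0 := by linarith
  have hβ0 : β ≠ 0 := by
    rintro rfl
    rw [div_zero, add_zero, div_eq_one_iff_eq hα0] at h
    linarith
  have hm : (α - 1) * (β - 1) = 1 := by
    field_simp at h
    linarith
  rcases lt_trichotomy u 0 with hu | hu | hu
  · have hp : (0 : ℝ) < (-u) ^ (α - 1) := Real.rpow_pos_of_pos (by linarith) _
    simp only [Phi, Real.sign_of_neg hu, abs_of_neg hu, mul_neg, mul_one, abs_neg, abs_of_pos hp]
    rw [Real.sign_of_neg (by linarith), ← Real.rpow_mul (by linarith), hm, Real.rpow_one]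
    ring
  · simp [Phi, hu]
  · have hp : (0 : ℝ) < u ^ (α - 1) := Real.rpow_pos_of_pos hu _
    simp only [Phi, Real.sign_of_pos hu, abs_of_pos hu, mul_one, abs_of_pos hp]
    rw [Real.sign_of_pos hp, ← Real.rpow_mul hu.le, hm, Real.rpow_one, mul_one]

/-! ### Regular variation. All notions depend only on the function near infinity. -/

/-- `f ∈ RV(θ)`: `f` is positive and measurable on some half-line, and `f(λt)/f(t) → λ^θ` as
`t → ∞` for every `λ > 0`. -/
def IsRV (θ : ℝ) (f : ℝ → ℝ) : Prop :=
  (∃ b : ℝ, (∀ t ∈ Ici b, 0 < f t) ∧ Measurable (fun t : Ici b => f t)) ∧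
    ∀ l : ℝ, 0 < l → Tendsto (fun t => f (l * t) / f t) atTop (𝓝 (l ^ θ))

/-- Slowly varying functions, `SV = RV(0)`. -/
def SV : Set (ℝ → ℝ) := {f | IsRV 0 f}

/-- `f ∈ NRV(θ)`: `f(t) = C t^θ exp (∫_{t₀}^t ψ(s)/s ds)` for `t ≥ t₀`, with `t₀ > 0`, a constant
`C ∈ (0,∞)` and a measurable `ψ` tending to `0`. -/
def IsNRV (θ : ℝ) (f : ℝ → ℝ) : Prop :=
  ∃ (t₀ C : ℝ) (ψ : ℝ → ℝ), 0 < t₀ ∧ 0 < C ∧ Measurable ψ ∧ Tendsto ψ atTop (𝓝 0) ∧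
    ∀ t, t₀ ≤ t → IntervalIntegrable (fun s => ψ s / s) volume t₀ t ∧
      f t = C * t ^ θ * Real.exp (∫ s in t₀..t, ψ s / s)

/-- Normalized slowly varying functions. -/
def NSV : Set (ℝ → ℝ) := {f | IsNRV 0 f}

/-- The slowly varying component `L_f(t) = f(t)/t^θ` of `f ∈ RV(θ)`. -/
def slowPart (θ : ℝ) (f : ℝ → ℝ) (t : ℝ) : ℝ := f t / t ^ θ

/-- `f ∈ Π(w)`, the de Haan class with auxiliary function `w`. -/
def InPi (f w : ℝ → ℝ) : Prop :=
  (∃ b : ℝ, Measurable (fun t : Ici b => f t)) ∧ (∀ᶠ t in atTop, 0 < w t) ∧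
    ∀ l : ℝ, 0 < l → Tendsto (fun t => (f (l * t) - f t) / w t) atTop (𝓝 (Real.log l))

/-! ### The equation `(r Φ(y'))' = p Φ(y(τ))` -/

/-- `y` is a classical solution on the interval `I`: `y` and `r Φ(y')` are `C¹` on `I`, and the
equation holds at each `t ∈ I` at which `y(τ(t))` is defined, that is, with `τ(t) ∈ I`.
(Derivatives at an endpoint of `I` are one-sided.) -/
def IsSolutionOn (α : ℝ) (r p τ y : ℝ → ℝ) (I : Set ℝ) : Prop :=
  ContDiffOn ℝ 1 y I ∧
  ContDiffOn ℝ 1 (fun t => r t * Phi α (derivWithin y I t)) I ∧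
  ∀ t ∈ I, τ t ∈ I →
    derivWithin (fun s => r s * Phi α (derivWithin y I s)) I t = p t * Phi α (y (τ t))

/-- The class `𝒮` of functions that are positive solutions for large `t`. -/
def Sol (a α : ℝ) (r p τ : ℝ → ℝ) : Set (ℝ → ℝ) :=
  {y | ∃ b : ℝ, a ≤ b ∧ IsSolutionOn α r p τ y (Ici b) ∧ ∀ t ∈ Ici b, 0 < y t}

/-- The class `ℐ𝒮` of eventually positive increasing solutions. -/
def IncSol (a α : ℝ) (r p τ : ℝ → ℝ) : Set (ℝ → ℝ) :=
  {y | y ∈ Sol a α r p τ ∧ ∀ᶠ t in atTop, 0 < deriv y t}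

/-- The quasiderivative `y^{[1]} = r Φ(y')`. -/
def quasiDeriv (α : ℝ) (r y : ℝ → ℝ) (t : ℝ) : ℝ := r t * Phi α (deriv y t)

/-- The two kinds of limits at infinity in the classification of solutions: a nonzero real
number, or `∞`. -/
inductive LimKind
  | B
  | inf

/-- `f` has a limit at infinity of the given kind. -/
def LimKind.Holds : LimKind → (ℝ → ℝ) → Prop
  | .B, f => ∃ c : ℝ, c ≠ 0 ∧ Tendsto f atTop (𝓝 c)
  | .inf, f => Tendsto f atTop atTop

/-- The class `ℐ𝒮_{u,v}`, where `u` describes the limit of `y` and `v` that of `y^{[1]}`. -/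
def IncSolLim (a α : ℝ) (r p τ : ℝ → ℝ) (u v : LimKind) : Set (ℝ → ℝ) :=
  {y | y ∈ IncSol a α r p τ ∧ u.Holds y ∧ v.Holds (quasiDeriv α r y)}

/-- `G(t) = Φ⁻¹(t p(t)/r(t))`, where `Φ⁻¹ = Phi β`. -/
def G (β : ℝ) (r p : ℝ → ℝ) (t : ℝ) : ℝ := Phi β (t * p t / r t)

end HalfLinear

end

open HalfLinear

/-!
The asymptotics of the solutions follow from Karamata's theorem applied to the quasiderivative.

Let `y` be an increasing solution, `P(t) = ∫_a^t p` and `y^{[1]} = r Φ(y')`. As `y` increases and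
`τ(t) ≤ t`, integration of the equation gives `y^{[1]} ≤ (C + P) y^(α-1)`, so that
`(t y'/y)^(α-1) ≤ (t^(α-1)/r) (C + P) → 0`. Hence `t y'/y → 0`, which is normalized slow variation
(`tendsto_mul_deriv_div_of_mem_IncSol`, `mem_NSV_of_tendsto`). On the other hand
`y^{[1]} ≥ c P + const → ∞`.

Let `p ∈ RV(δ)` with `δ > -1`. Since `c t ≤ τ(t) ≤ t` and `y` is monotone and slowly varying,
`y(τ(t)) ∼ y(t)`, so `(y^{[1]})' = p Φ(y(τ)) ∈ RV(δ)`, and Karamata's theorem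
(`IsRV.tendsto_mul_div_antideriv`) yields `t p Φ(y) / (r Φ(y')) → δ + 1`. Taking the power `β - 1`
gives `y'/y ∼ G/Φ⁻¹(δ+1)` (`tendsto_logDeriv_div_G`), and both exponential formulas are this
relation integrated. A slowly varying solution cannot decrease: its quasiderivative would be
nonpositive, yet have a derivative at least `p y^(α-1) ∈ RV(δ)`, and so tend to `∞`
(`mem_IncSol_of_mem_SV`).

If moreover `r ∈ RV(γ)`, then `G ∈ RV((δ+1-γ)(β-1))` and `t^(α-1) P / r ∈ RV(α+δ-γ)`, and the
latter tends to `0` only if `γ ≥ α + δ`. For `γ = α + δ` one gets `y' ∈ RV(-1)`, which gives both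
`y ∈ Π(ty')` and `t y' = o(N - y)`.

The facts on regular variation are needed for continuous functions only. They rest on the local
boundedness of `f(st)/f(t)` (`IsRV.exists_local_bound`), which comes from the Baire category
theorem, and on `(F(lt) - F(t))/(t f(t)) → ∫_1^l s^θ ds` for `F' = f ∈ RV(θ)`
(`IsRV.tendsto_increment`), a consequence by dominated convergence.
-/

namespace HalfLinear

/-! ### Comparison of functions through their derivatives -/

theorem tendsto_const_mul_atTop_self {l : ℝ} (hl : 0 < l) :
    Tendsto (fun t : ℝ => l * t) atTop atTop := tendsto_id.const_mul_atTop hl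

/-- L'Hôpital's rule for a denominator that tends to `∞`; nothing is required of the numerator. -/
theorem tendsto_div_of_tendsto_deriv_div {F H f h : ℝ → ℝ} {L : ℝ}
    (hF : ∀ᶠ t in atTop, HasDerivAt F (f t) t) (hH : ∀ᶠ t in atTop, HasDerivAt H (h t) t)
    (hpos : ∀ᶠ t in atTop, 0 < h t) (htop : Tendsto H atTop atTop)
    (hlim : Tendsto (fun t => f t / h t) atTop (𝓝 L)) :
    Tendsto (fun t => F t / H t) atTop (𝓝 L) := by
  have upper : ∀ {F f : ℝ → ℝ} {L : ℝ}, (∀ᶠ t in atTop, HasDerivAt F (f t) t) →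
      Tendsto (fun t => f t / h t) atTop (𝓝 L) → ∀ M, L < M → ∀ᶠ t in atTop, F t / H t < M := by
    intro F f L hF hlim M hM
    obtain ⟨M', hM1, hM2⟩ := exists_between hM
    obtain ⟨T, hT⟩ := eventually_atTop.1
      (hF.and (hH.and (hpos.and (hlim.eventually_lt_const hM1))))
    have hd : ∀ t, T ≤ t → HasDerivAt (fun t => F t - M' * H t) (f t - M' * h t) t := fun t ht =>
      (hT t ht).1.sub ((hT t ht).2.1.const_mul M')
    have hanti : AntitoneOn (fun t => F t - M' * H t) (Ici T) := by
      refine antitoneOn_of_deriv_nonpos (convex_Ici T)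
        (fun t ht => (hd t ht).continuousAt.continuousWithinAt)
        (fun t ht => (hd t (interior_subset ht)).differentiableAt.differentiableWithinAt) ?_
      intro t ht
      have ht' := hT t (interior_subset ht)
      rw [(hd t (interior_subset ht)).deriv]
      have := (div_lt_iff₀ ht'.2.2.1).1 ht'.2.2.2
      linarith
    have hC : Tendsto (fun t => M' + (F T - M' * H T) / H t) atTop (𝓝 (M' + 0)) :=
      tendsto_const_nhds.add (tendsto_const_nhds.div_atTop htop)
    rw [add_zero] at hC
    filter_upwards [hC.eventually_lt_const hM2, eventually_ge_atTop T,
      htop.eventually_gt_atTop 0] with t h1 h2 h3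
    refine lt_of_le_of_lt ?_ h1
    have := hanti self_mem_Ici h2 h2
    simp only at this
    rw [div_le_iff₀ h3, add_mul, div_mul_cancel₀ _ h3.ne']
    linarith
  refine tendsto_order.2 ⟨fun M hM => ?_, upper hF hlim⟩
  have := upper (F := fun t => - F t) (f := fun t => - f t) (L := -L)
    (hF.mono fun t ht => ht.neg) (by simpa [neg_div] using hlim.neg) (-M) (by linarith)
  filter_upwards [this] with t ht
  rw [neg_div] at ht
  linarith

theorem tendsto_atTop_of_deriv_le {F H f h : ℝ → ℝ}
    (hF : ∀ᶠ t in atTop, HasDerivAt F (f t) t) (hH : ∀ᶠ t in atTop, HasDerivAt H (h t) t)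
    (hle : ∀ᶠ t in atTop, h t ≤ f t) (htop : Tendsto H atTop atTop) : Tendsto F atTop atTop := by
  obtain ⟨T, hT⟩ := eventually_atTop.1 (hF.and (hH.and hle))
  have hd : ∀ t, T ≤ t → HasDerivAt (fun t => F t - H t) (f t - h t) t := fun t ht =>
    (hT t ht).1.sub (hT t ht).2.1
  have hmono : MonotoneOn (fun t => F t - H t) (Ici T) := by
    refine monotoneOn_of_deriv_nonneg (convex_Ici T)
      (fun t ht => (hd t ht).continuousAt.continuousWithinAt)
      (fun t ht => (hd t (interior_subset ht)).differentiableAt.differentiableWithinAt) ?_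
    intro t ht
    rw [(hd t (interior_subset ht)).deriv]
    exact sub_nonneg.2 (hT t (interior_subset ht)).2.2
  refine tendsto_atTop_mono' atTop ?_ (tendsto_atTop_add_const_left atTop (F T - H T) htop)
  filter_upwards [eventually_ge_atTop T] with t ht
  have := hmono self_mem_Ici ht ht
  simp only at this
  linarith

theorem eventually_hasDerivAt_comp_const_mul {f F : ℝ → ℝ}
    (hF : ∀ᶠ t in atTop, HasDerivAt F (f t) t) {l : ℝ} (hl : 0 < l) :
    ∀ᶠ t in atTop, HasDerivAt (fun t => F (l * t)) (l * f (l * t)) t := by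
  filter_upwards [(tendsto_const_mul_atTop_self hl).eventually hF] with t ht
  have h1 : HasDerivAt (fun s : ℝ => l * s) l t := by simpa using (hasDerivAt_id t).const_mul l
  have := HasDerivAt.comp t ht h1
  rw [mul_comm] at this
  exact this

theorem eventually_pos_of_deriv_neg {F f : ℝ → ℝ} (hF : ∀ᶠ t in atTop, HasDerivAt F (-f t) t)
    (hf : ∀ᶠ t in atTop, 0 < f t) (h0 : Tendsto F atTop (𝓝 0)) : ∀ᶠ t in atTop, 0 < F t := by
  obtain ⟨T, hT⟩ := eventually_atTop.1 (hF.and hf)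
  have hanti : StrictAntiOn F (Ici T) := by
    refine strictAntiOn_of_deriv_neg (convex_Ici T)
      (fun t ht => (hT t ht).1.continuousAt.continuousWithinAt) fun t ht => ?_
    have h := hT t (interior_subset ht)
    rw [h.1.deriv]
    linarith [h.2]
  filter_upwards [eventually_ge_atTop T] with t ht
  have h1 : F (t + 1) < F t := hanti ht (show T ≤ t + 1 by linarith) (by linarith)
  refine lt_of_le_of_lt (le_of_tendsto h0 ?_) h1
  filter_upwards [eventually_ge_atTop (t + 1)] with s hs
  exact hanti.antitoneOn (show T ≤ t + 1 by linarith) (show T ≤ s by linarith) hs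

theorem hasDerivAt_log_comp {y : ℝ → ℝ} {t : ℝ} (h0 : 0 < y t) (hd : HasDerivAt y (deriv y t) t) :
    HasDerivAt (fun s => Real.log (y s)) (deriv y t / y t) t := hd.log h0.ne'

theorem hasDerivAt_primitive {g : ℝ → ℝ} {a : ℝ} (hg : ContinuousOn g (Ici a)) {t : ℝ}
    (ht : a < t) : HasDerivAt (fun t => ∫ s in a..t, g s) (g t) t := by
  refine intervalIntegral.integral_hasDerivAt_right ?_ ?_ (hg.continuousAt (Ici_mem_nhds ht))
  · refine (hg.mono ?_).intervalIntegrable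
    rw [uIcc_of_le ht.le]
    exact Icc_subset_Ici_self
  · exact (hg.mono Ioi_subset_Ici_self).stronglyMeasurableAtFilter isOpen_Ioi t ht

theorem hasDerivAt_tail {g : ℝ → ℝ} {a : ℝ} (hg : ContinuousOn g (Ici a))
    (hint : IntegrableOn g (Ioi a)) {t : ℝ} (ht : a < t) :
    HasDerivAt (fun t => ∫ s in Ioi t, g s) (-g t) t := by
  refine ((hasDerivAt_primitive hg ht).const_sub (∫ s in Ioi a, g s)).congr_of_eventuallyEq ?_
  filter_upwards [Ioi_mem_nhds ht] with u hu
  rw [← intervalIntegral.integral_Ioi_sub_Ioi hint (le_of_lt hu), sub_sub_cancel]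

/-! ### Closure properties of regular variation -/

theorem IsRV.eventually_pos {θ : ℝ} {f : ℝ → ℝ} (hf : IsRV θ f) : ∀ᶠ t in atTop, 0 < f t := by
  obtain ⟨⟨b, hb, -⟩, -⟩ := hf
  filter_upwards [eventually_ge_atTop b] with t ht using hb t ht

theorem isRV_of_eventually {θ : ℝ} {f : ℝ → ℝ} (h0 : ∀ᶠ t in atTop, 0 < f t)
    (hc : ∀ᶠ t in atTop, ContinuousAt f t)
    (h : ∀ l : ℝ, 0 < l → Tendsto (fun t => f (l * t) / f t) atTop (𝓝 (l ^ θ))) : IsRV θ f := by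
  obtain ⟨b, hb⟩ := eventually_atTop.1 (h0.and hc)
  refine ⟨⟨b, fun t ht => (hb t ht).1, Continuous.measurable ?_⟩, h⟩
  exact continuousOn_iff_continuous_domRestrict.1 fun t ht => (hb t ht).2.continuousWithinAt

theorem IsRV.of_equivalent {θ : ℝ} {f g : ℝ → ℝ} (hg : IsRV θ g)
    (hc : ∀ᶠ t in atTop, ContinuousAt f t) (h : Tendsto (fun t => f t / g t) atTop (𝓝 1)) :
    IsRV θ f := by
  have hpos : ∀ᶠ t in atTop, 0 < f t := by
    filter_upwards [hg.eventually_pos, h.eventually_const_lt one_pos] with t h1 h2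
    exact (div_pos_iff_of_pos_right h1).1 h2
  refine isRV_of_eventually hpos hc fun l hl => ?_
  have hmul := tendsto_const_mul_atTop_self hl
  have h1 := ((h.comp hmul).mul (hg.2 l hl)).div h one_ne_zero
  rw [one_mul, div_one] at h1
  refine h1.congr' ?_
  filter_upwards [hg.eventually_pos, hmul.eventually hg.eventually_pos, hpos] with t h2 h3 h4
  simp only [Function.comp, Pi.div_apply]
  field_simp

theorem IsRV.mul {θ η : ℝ} {f g : ℝ → ℝ} (hf : IsRV θ f) (hg : IsRV η g)
    (hfc : ∀ᶠ t in atTop, ContinuousAt f t) (hgc : ∀ᶠ t in atTop, ContinuousAt g t) :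
    IsRV (θ + η) (fun t => f t * g t) := by
  refine isRV_of_eventually ?_ ?_ fun l hl => ?_
  · filter_upwards [hf.eventually_pos, hg.eventually_pos] with t h1 h2 using mul_pos h1 h2
  · filter_upwards [hfc, hgc] with t h1 h2 using h1.mul h2
  · rw [Real.rpow_add hl]
    simpa only [mul_div_mul_comm] using (hf.2 l hl).mul (hg.2 l hl)

theorem IsRV.rpow {θ : ℝ} {f : ℝ → ℝ} (hf : IsRV θ f)
    (hfc : ∀ᶠ t in atTop, ContinuousAt f t) (κ : ℝ) :
    IsRV (θ * κ) (fun t => f t ^ κ) := by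
  refine isRV_of_eventually ?_ ?_ fun l hl => ?_
  · filter_upwards [hf.eventually_pos] with t h1 using Real.rpow_pos_of_pos h1 _
  · filter_upwards [hfc, hf.eventually_pos] with t h1 h2 using h1.rpow_const (Or.inl h2.ne')
  · rw [Real.rpow_mul hl.le]
    refine ((hf.2 l hl).rpow_const (Or.inl (Real.rpow_pos_of_pos hl _).ne')).congr' ?_
    filter_upwards [hf.eventually_pos,
      (tendsto_const_mul_atTop_self hl).eventually hf.eventually_pos] with t h1 h2
    rw [Real.div_rpow h2.le h1.le]

theorem IsRV.const_mul {θ : ℝ} {f : ℝ → ℝ} (hf : IsRV θ f)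
    (hfc : ∀ᶠ t in atTop, ContinuousAt f t) {c : ℝ} (hc : 0 < c) : IsRV θ (fun t => c * f t) := by
  refine isRV_of_eventually (hf.eventually_pos.mono fun t h => mul_pos hc h)
    (hfc.mono fun t h => h.const_mul c) fun l hl => ?_
  simpa only [mul_div_mul_left _ _ hc.ne'] using hf.2 l hl

theorem isRV_rpow (κ : ℝ) : IsRV κ (fun t => t ^ κ) := by
  refine isRV_of_eventually ?_ ?_ fun l hl => ?_
  · filter_upwards [eventually_gt_atTop 0] with t h1 using Real.rpow_pos_of_pos h1 _
  · filter_upwards [eventually_gt_atTop 0] with t h1 using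
      continuousAt_id.rpow_const (Or.inl h1.ne')
  · refine tendsto_const_nhds.congr' ?_
    filter_upwards [eventually_gt_atTop 0] with t h1
    rw [Real.mul_rpow hl.le h1.le, mul_div_cancel_right₀ _ (Real.rpow_pos_of_pos h1 _).ne']

theorem eventually_continuousAt_rpow (κ : ℝ) :
    ∀ᶠ t : ℝ in atTop, ContinuousAt (fun t => t ^ κ) t := by
  filter_upwards [eventually_gt_atTop 0] with t h1 using continuousAt_id.rpow_const (Or.inl h1.ne')

/-! ### Local boundedness and Karamata's theorem -/

/-- The uniform convergence theorem for slowly varying functions, in additive form. By the Baire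
category theorem some set `{u | ∀ x ≥ n, |h (x + u) - h x| ≤ ε}` contains an interval, and
differences of its elements cover a neighbourhood of `0`. -/
theorem tendstoLocallyUniformly_sub_of_tendsto {h : ℝ → ℝ} (hc : Continuous h)
    (hlim : ∀ u, Tendsto (fun x => h (x + u) - h x) atTop (𝓝 0)) :
    TendstoLocallyUniformly (fun x u => h (x + u) - h x) (fun _ => 0) atTop := by
  have key : ∀ ε > 0, ∃ η > 0, ∀ᶠ x in atTop, ∀ v, |v| < η → |h (x + v) - h x| ≤ 2 * ε := by
    intro ε hε
    let E : ℕ → Set ℝ := fun n => {u | ∀ x, (n : ℝ) ≤ x → |h (x + u) - h x| ≤ ε}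
    have hclosed : ∀ n, IsClosed (E n) := by
      intro n
      have : E n = ⋂ x, ⋂ (_ : (n : ℝ) ≤ x), {u | |h (x + u) - h x| ≤ ε} := by
        ext u; simp [E]
      rw [this]
      refine isClosed_iInter fun x => isClosed_iInter fun _ => ?_
      exact isClosed_le (by fun_prop) continuous_const
    have hunion : ⋃ n, E n = univ := by
      refine eq_univ_of_forall fun u => mem_iUnion.2 ?_
      have h1 := (hlim u).eventually (Metric.ball_mem_nhds 0 hε)
      obtain ⟨X, hX⟩ := eventually_atTop.1 h1
      obtain ⟨n, hn⟩ := exists_nat_ge X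
      refine ⟨n, fun x hx => ?_⟩
      have := hX x (hn.trans hx)
      rw [Real.dist_0_eq_abs] at this
      exact this.le
    obtain ⟨n, c, hcn⟩ := nonempty_interior_of_iUnion_of_closed hclosed hunion
    obtain ⟨η, hη, hball⟩ := Metric.isOpen_iff.1 isOpen_interior c hcn
    refine ⟨η, hη, ?_⟩
    filter_upwards [eventually_ge_atTop (n + c)] with x hx v hv
    -- `h (x + v) - h x` is the difference of the increments by `c + v` and by `c` from `x - c`.
    have h1 : c + v ∈ E n := interior_subset (hball (by simpa [Real.dist_eq] using hv))
    have h2 : c ∈ E n := interior_subset hcn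
    have h1' := h1 (x - c) (by linarith)
    have h2' := h2 (x - c) (by linarith)
    rw [show x - c + (c + v) = x + v by ring] at h1'
    rw [sub_add_cancel] at h2'
    rw [abs_le] at *
    constructor <;> linarith [h1'.1, h1'.2, h2'.1, h2'.2]
  rw [Metric.tendstoLocallyUniformly_iff]
  intro ε hε u
  obtain ⟨η, hη, hk⟩ := key (ε / 4) (by linarith)
  refine ⟨Metric.ball u η, Metric.ball_mem_nhds u hη, ?_⟩
  have h1 := (hlim u).eventually (Metric.ball_mem_nhds 0 (show 0 < ε / 4 by linarith))
  have h2 := (tendsto_atTop_add_const_right atTop u tendsto_id).eventually hk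
  filter_upwards [h1, h2] with x hx1 hx2 v hv
  have hx3 := hx2 (v - u) (by simpa [Real.dist_eq] using hv)
  simp only [id] at hx3
  rw [show x + u + (v - u) = x + v by ring, abs_le] at hx3
  rw [Real.dist_0_eq_abs, abs_lt] at hx1
  rw [Real.dist_eq, abs_lt]
  constructor <;> linarith [hx1.1, hx1.2, hx3.1, hx3.2]

/-- The quotients `f (s * t) / f t` are bounded for `s` in a compact subset of `(0, ∞)` and large
`t`. This is what dominated convergence needs in `IsRV.tendsto_increment`. -/
theorem IsRV.exists_local_bound {θ : ℝ} {f : ℝ → ℝ} (hf : IsRV θ f)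
    (hc : ∀ᶠ t in atTop, ContinuousAt f t) {c : ℝ} (hc0 : 0 < c) (d : ℝ) :
    ∃ K : ℝ, ∀ᶠ t in atTop, ∀ s ∈ Icc c d, f (s * t) ≤ K * f t := by
  obtain ⟨b, hb⟩ := eventually_atTop.1 (hf.eventually_pos.and hc)
  -- `g` is a continuous positive extension of `f` from `[b, ∞)` to the line.
  let g : ℝ → ℝ := fun t => f (max t b)
  have hg0 : ∀ t, 0 < g t := fun t => (hb _ (le_max_right _ _)).1
  have hgc : Continuous g := by
    refine continuous_iff_continuousAt.2 fun t => ?_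
    exact ContinuousAt.comp (f := fun t => max t b) (hb _ (le_max_right _ _)).2 (by fun_prop)
  have hgf : ∀ t, b ≤ t → g t = f t := fun t ht => by simp [g, ht]
  let h : ℝ → ℝ := fun x => Real.log (g (Real.exp x)) - θ * x
  have hhc : Continuous h := by
    have : Continuous fun x => Real.log (g (Real.exp x)) :=
      Continuous.log (hgc.comp Real.continuous_exp) fun x => (hg0 _).ne'
    fun_prop
  have hlim : ∀ u, Tendsto (fun x => h (x + u) - h x) atTop (𝓝 0) := by
    intro u
    have h1 := ((hf.2 (Real.exp u) (Real.exp_pos u)).comp Real.tendsto_exp_atTop).log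
      (Real.rpow_pos_of_pos (Real.exp_pos u) θ).ne'
    rw [Real.log_rpow (Real.exp_pos u), Real.log_exp] at h1
    have h2 := h1.sub_const (θ * u)
    rw [sub_self] at h2
    refine h2.congr' ?_
    filter_upwards [Real.tendsto_exp_atTop.eventually_ge_atTop b,
      ((tendsto_const_mul_atTop_self (Real.exp_pos u)).comp
        Real.tendsto_exp_atTop).eventually_ge_atTop b] with x hx1 hx2
    simp only [Function.comp] at hx2 ⊢
    simp only [h]
    rw [add_comm x u, Real.exp_add, hgf _ hx1, hgf _ hx2,
      Real.log_div (hb _ hx2).1.ne' (hb _ hx1).1.ne']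
    ring
  have hU := (tendstoLocallyUniformly_iff_forall_isCompact.1
    (tendstoLocallyUniformly_sub_of_tendsto hhc hlim)) _
      (isCompact_Icc (a := Real.log c) (b := Real.log d))
  have hU1 := Metric.tendstoUniformlyOn_iff.1 hU 1 one_pos
  obtain ⟨B, hB⟩ := (isCompact_Icc (a := Real.log c) (b := Real.log d)).exists_bound_of_continuousOn
    (f := fun u => θ * u) (by fun_prop)
  refine ⟨Real.exp (1 + B), ?_⟩
  filter_upwards [Real.tendsto_log_atTop.eventually hU1, eventually_ge_atTop b,
    (tendsto_const_mul_atTop_self hc0).eventually_ge_atTop b, eventually_gt_atTop 0]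
    with t ht1 ht2 ht3 ht4 s hs
  have hs0 : 0 < s := hc0.trans_le hs.1
  have hst : b ≤ s * t := ht3.trans (by nlinarith [hs.1])
  have hlog : Real.log s ∈ Icc (Real.log c) (Real.log d) :=
    ⟨Real.log_le_log hc0 hs.1, Real.log_le_log hs0 hs.2⟩
  have h3 := ht1 _ hlog
  have h4 := hB _ hlog
  simp only [h] at h3
  rw [Real.exp_add, Real.exp_log ht4, Real.exp_log hs0, mul_comm t s, hgf _ ht2, hgf _ hst,
    Real.dist_eq, abs_lt] at h3
  rw [Real.norm_eq_abs, abs_le] at h4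
  have h5 : Real.log (f (s * t)) ≤ (1 + B) + Real.log (f t) := by linarith [h3.1, h4.2]
  have h6 := Real.exp_le_exp.2 h5
  rwa [Real.exp_add, Real.exp_log (hb _ hst).1, Real.exp_log (hb _ ht2).1] at h6

/-- An antiderivative of `f ∈ RV(θ)` has increments of the order of `t f(t)`. For `θ = -1` this says
that it belongs to de Haan's class `Π(t f(t))`. -/
theorem IsRV.tendsto_increment {θ : ℝ} {f F : ℝ → ℝ} (hf : IsRV θ f)
    (hc : ∀ᶠ t in atTop, ContinuousAt f t) (hF : ∀ᶠ t in atTop, HasDerivAt F (f t) t)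
    {l : ℝ} (hl : 0 < l) :
    Tendsto (fun t => (F (l * t) - F t) / (t * f t)) atTop (𝓝 (∫ s in (1 : ℝ)..l, s ^ θ)) := by
  obtain ⟨b, hb⟩ := eventually_atTop.1 (hf.eventually_pos.and (hc.and hF))
  have hm : 0 < min 1 l := lt_min one_pos hl
  obtain ⟨K, hK⟩ := hf.exists_local_bound hc hm (max 1 l)
  have hsub : uIoc 1 l ⊆ Icc (min 1 l) (max 1 l) := Ioc_subset_Icc_self
  have hev : ∀ᶠ t : ℝ in atTop, 0 < t ∧ b ≤ t ∧ b ≤ min 1 l * t :=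
    (eventually_gt_atTop 0).and ((eventually_ge_atTop b).and
      ((tendsto_const_mul_atTop_self hm).eventually_ge_atTop b))
  have hcont : ∀ t, 0 < t → b ≤ min 1 l * t →
      ContinuousOn (fun s => f (s * t)) (Icc (min 1 l) (max 1 l)) := by
    intro t h0 h1 s hs
    refine ContinuousAt.continuousWithinAt ?_
    have hst : b ≤ s * t := h1.trans (by nlinarith [hs.1])
    exact ContinuousAt.comp (f := fun s => s * t) (hb _ hst).2.1 (by fun_prop)
  have hint : Tendsto (fun t => ∫ s in (1 : ℝ)..l, f (s * t) / f t) atTop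
      (𝓝 (∫ s in (1 : ℝ)..l, s ^ θ)) := by
    refine intervalIntegral.tendsto_integral_filter_of_dominated_convergence (fun _ => K) ?_ ?_
      intervalIntegrable_const ?_
    · filter_upwards [hev] with t ht
      exact (((hcont t ht.1 ht.2.2).div_const _).mono hsub).aestronglyMeasurable
        measurableSet_uIoc
    · filter_upwards [hev, hK] with t ht hKt
      refine Eventually.of_forall fun s hs => ?_
      have hs' := hsub hs
      have hft := (hb t ht.2.1).1
      have hst : b ≤ s * t := ht.2.2.trans (by nlinarith [hs'.1])
      rw [Real.norm_eq_abs, abs_of_pos (div_pos (hb _ hst).1 hft), div_le_iff₀ hft]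
      exact hKt s hs'
    · exact Eventually.of_forall fun s hs => hf.2 s (hm.trans_le (hsub hs).1)
  refine hint.congr' ?_
  filter_upwards [hev] with t ht
  have hft := (hb t ht.2.1).1
  have hFTC : ∫ s in (1 : ℝ)..l, t * f (s * t) = F (l * t) - F (1 * t) := by
    refine intervalIntegral.integral_eq_sub_of_hasDerivAt (f := fun s => F (s * t)) ?_ ?_
    · intro s hs
      have hst : b ≤ s * t := ht.2.2.trans (mul_le_mul_of_nonneg_right hs.1 ht.1.le)
      have h1 : HasDerivAt (fun s : ℝ => s * t) t s := by
        simpa using (hasDerivAt_id s).mul_const t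
      have := HasDerivAt.comp s (hb _ hst).2.2 h1
      rw [mul_comm] at this
      exact this
    · exact ((hcont t ht.1 ht.2.2).const_mul t).intervalIntegrable
  rw [intervalIntegral.integral_const_mul, one_mul] at hFTC
  rw [intervalIntegral.integral_div, ← hFTC, mul_div_mul_left _ _ ht.1.ne']

theorem IsRV.tendsto_deriv_comp_div {θ : ℝ} {f : ℝ → ℝ} (hf : IsRV θ f) {l : ℝ} (hl : 0 < l) :
    Tendsto (fun t => l * f (l * t) / f t) atTop (𝓝 (l ^ (θ + 1))) := by
  have := (hf.2 l hl).const_mul l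
  rw [Real.rpow_add_one hl.ne', mul_comm _ l]
  simpa only [mul_div_assoc] using this

theorem IsRV.tendsto_antideriv_ratio {θ : ℝ} {f F : ℝ → ℝ} (hf : IsRV θ f)
    (hF : ∀ᶠ t in atTop, HasDerivAt F (f t) t) (htop : Tendsto F atTop atTop)
    {l : ℝ} (hl : 0 < l) :
    Tendsto (fun t => F (l * t) / F t) atTop (𝓝 (l ^ (θ + 1))) :=
  tendsto_div_of_tendsto_deriv_div (eventually_hasDerivAt_comp_const_mul hF hl) hF
    hf.eventually_pos htop (hf.tendsto_deriv_comp_div hl)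

theorem IsRV.tendsto_tail_ratio {θ : ℝ} {f F : ℝ → ℝ} (hf : IsRV θ f)
    (hF : ∀ᶠ t in atTop, HasDerivAt F (-f t) t) (h0 : Tendsto F atTop (𝓝 0))
    {l : ℝ} (hl : 0 < l) :
    Tendsto (fun t => F (l * t) / F t) atTop (𝓝 (l ^ (θ + 1))) := by
  refine HasDerivAt.lhopital_zero_atTop (eventually_hasDerivAt_comp_const_mul hF hl) hF
    (hf.eventually_pos.mono fun t ht => (neg_neg_of_pos ht).ne)
    (h0.comp (tendsto_const_mul_atTop_self hl)) h0 ?_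
  simpa only [mul_neg, neg_div_neg_eq] using hf.tendsto_deriv_comp_div hl

/-- Karamata's theorem: `t f(t) / F(t) → θ + 1` for an antiderivative `F` of `f ∈ RV(θ)`, `θ > -1`.
Both `(F(2t) - F(t)) / (t f(t))` and `F(2t) / F(t)` have known limits. -/
theorem IsRV.tendsto_mul_div_antideriv {θ : ℝ} {f F : ℝ → ℝ} (hf : IsRV θ f)
    (hc : ∀ᶠ t in atTop, ContinuousAt f t) (hθ : -1 < θ)
    (hF : ∀ᶠ t in atTop, HasDerivAt F (f t) t) (htop : Tendsto F atTop atTop) :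
    Tendsto (fun t => t * f t / F t) atTop (𝓝 (θ + 1)) := by
  have h1 := hf.tendsto_increment hc hF two_pos
  have h2 := (hf.tendsto_antideriv_ratio hF htop two_pos).sub_const 1
  have hJ : ∫ s in (1 : ℝ)..2, s ^ θ = ((2 : ℝ) ^ (θ + 1) - 1) / (θ + 1) := by
    rw [integral_rpow (Or.inl hθ), Real.one_rpow]
  have hpow : (1 : ℝ) < 2 ^ (θ + 1) := Real.one_lt_rpow one_lt_two (by linarith)
  have hθ1 : θ + 1 ≠ 0 := by linarith
  rw [hJ] at h1
  have h3 := h2.div h1 (div_ne_zero (by linarith) hθ1)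
  rw [div_div_cancel₀ (by linarith)] at h3
  refine h3.congr' ?_
  filter_upwards [(h2.eventually_const_lt (u := 0) (by linarith)), hf.eventually_pos,
    eventually_gt_atTop 0, htop.eventually_gt_atTop 0] with t h4 h5 h6 h7
  rw [div_sub_one h7.ne'] at h4
  rw [Pi.div_apply, div_sub_one h7.ne']
  have h8 : F (2 * t) - F t ≠ 0 := by
    intro h; rw [h] at h4; simp at h4
  field_simp

/-- The limiting case `θ = -1` of Karamata's theorem, where `t f(t)` is negligible compared with the
tail integral `F` of `f`. -/
theorem IsRV.tendsto_mul_div_tail {f F : ℝ → ℝ} (hf : IsRV (-1) f)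
    (hc : ∀ᶠ t in atTop, ContinuousAt f t)
    (hF : ∀ᶠ t in atTop, HasDerivAt F (-f t) t) (h0 : Tendsto F atTop (𝓝 0))
    (hpos : ∀ᶠ t in atTop, 0 < F t) :
    Tendsto (fun t => t * f t / F t) atTop (𝓝 0) := by
  have h1 := hf.tendsto_increment hc (F := fun t => - F t)
    (hF.mono fun t ht => by rw [← neg_neg (f t)]; exact ht.neg) two_pos
  have h2 := (hf.tendsto_tail_ratio hF h0 two_pos).const_sub 1
  have hlog : (0 : ℝ) < Real.log 2 := Real.log_pos one_lt_two
  have hJ : ∫ s in (1 : ℝ)..2, s ^ (-1 : ℝ) = Real.log 2 := by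
    simp only [Real.rpow_neg_one]
    rw [integral_inv_of_pos one_pos two_pos, div_one]
  rw [hJ] at h1
  rw [neg_add_cancel, Real.rpow_zero, sub_self] at h2
  have h3 := h2.div h1 hlog.ne'
  rw [zero_div] at h3
  refine h3.congr' ?_
  filter_upwards [h1.eventually_const_lt hlog, hf.eventually_pos,
    eventually_gt_atTop 0, hpos] with t h4 h5 h6 h7
  have h8 : F t - F (2 * t) ≠ 0 := by
    intro h
    rw [show -F (2 * t) - -F t = F t - F (2 * t) by ring, h] at h4; simp at h4
  rw [Pi.div_apply, one_sub_div h7.ne', show -F (2 * t) - -F t = F t - F (2 * t) by ring]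
  field_simp

theorem IsRV.tendsto_zero {ρ : ℝ} {g : ℝ → ℝ} (hg : IsRV ρ g)
    (hc : ∀ᶠ t in atTop, ContinuousAt g t) (hρ : ρ < 0) : Tendsto g atTop (𝓝 0) := by
  have h2 : (2 : ℝ) ^ ρ < 1 := Real.rpow_lt_one_of_one_lt_of_neg one_lt_two hρ
  obtain ⟨q, hq1, hq2⟩ := exists_between h2
  have hq0 : 0 < q := (Real.rpow_pos_of_pos two_pos ρ).trans hq1
  obtain ⟨T, hT⟩ := eventually_atTop.1 ((eventually_gt_atTop 0).and (hg.eventually_pos.and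
    (hc.and ((hg.2 2 two_pos).eventually_lt_const hq1))))
  have hT0 : 0 < T := (hT T le_rfl).1
  obtain ⟨B, hB⟩ := (isCompact_Icc (a := T) (b := 2 * T)).exists_bound_of_continuousOn
    (f := g) fun t ht => (hT t ht.1).2.2.1.continuousWithinAt
  have hB0 : 0 ≤ B := (norm_nonneg _).trans (hB T ⟨le_rfl, by linarith⟩)
  -- Each doubling of the argument from `T` on multiplies `g` by less than `q < 1`.
  have hstep : ∀ t, 2 * T ≤ t → g t ≤ q * g (t / 2) := by
    intro t ht
    have h := hT (t / 2) (by linarith)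
    have h3 := (div_lt_iff₀ h.2.1).1 h.2.2.2
    rw [mul_div_cancel₀ t two_ne_zero] at h3
    exact h3.le
  have hbd : ∀ n : ℕ, ∀ t, T ≤ t → t ≤ 2 ^ n * (2 * T) → g t ≤ B := by
    intro n
    induction n with
    | zero => exact fun t h1 h3 => (le_abs_self _).trans (hB t ⟨h1, by simpa using h3⟩)
    | succ n ih =>
      intro t h1 h3
      rcases le_total t (2 * T) with h | h
      · exact (le_abs_self _).trans (hB t ⟨h1, h⟩)
      · have h4 := ih (t / 2) (by linarith) (by rw [pow_succ] at h3; linarith)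
        have h5 := (hT (t / 2) (by linarith)).2.1
        nlinarith [hstep t h]
  have hdecay : ∀ n : ℕ, ∀ t, 2 ^ n * T ≤ t → g t ≤ B * q ^ n := by
    intro n
    induction n with
    | zero =>
      intro t ht
      obtain ⟨n, hn⟩ := pow_unbounded_of_one_lt (t / (2 * T)) one_lt_two
      simpa using hbd n t (by simpa using ht) ((div_lt_iff₀ (by linarith)).1 hn).le
    | succ n ih =>
      intro t ht
      have h1 : (1 : ℝ) ≤ 2 ^ n := one_le_pow₀ one_le_two
      rw [pow_succ] at ht
      have h3 := ih (t / 2) (by linarith)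
      calc g t ≤ q * g (t / 2) := hstep t (by nlinarith)
        _ ≤ q * (B * q ^ n) := by gcongr
        _ = B * q ^ (n + 1) := by ring
  have hlim : Tendsto (fun n : ℕ => B * q ^ n) atTop (𝓝 (B * 0)) :=
    (tendsto_pow_atTop_nhds_zero_of_lt_one hq0.le hq2).const_mul B
  rw [mul_zero] at hlim
  refine tendsto_order.2 ⟨fun x hx => ?_, fun x hx => ?_⟩
  · filter_upwards [hg.eventually_pos] with t ht using hx.trans ht
  · obtain ⟨n, hn⟩ := (hlim.eventually_lt_const hx).exists
    filter_upwards [eventually_ge_atTop (2 ^ n * T)] with t ht using (hdecay n t ht).trans_lt hn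

theorem IsRV.tendsto_atTop {ρ : ℝ} {g : ℝ → ℝ} (hg : IsRV ρ g)
    (hc : ∀ᶠ t in atTop, ContinuousAt g t) (hρ : 0 < ρ) : Tendsto g atTop atTop := by
  have h1 := (hg.rpow hc (-1)).tendsto_zero
    (by filter_upwards [hc, hg.eventually_pos] with t h1 h2 using h1.rpow_const (Or.inl h2.ne'))
    (by linarith)
  simp only [Real.rpow_neg_one] at h1
  have h2 : Tendsto (fun t => (g t)⁻¹) atTop (𝓝[>] 0) :=
    tendsto_nhdsWithin_iff.2 ⟨h1, hg.eventually_pos.mono fun t ht => inv_pos.2 ht⟩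
  simpa [Function.comp_def] using tendsto_inv_nhdsGT_zero.comp h2

/-- Any function whose derivative dominates some `f ∈ RV(θ)` with `θ > -1` tends to `∞`, because
`t f(t) → ∞`. -/
theorem IsRV.antideriv_tendsto_atTop {θ : ℝ} {f F : ℝ → ℝ} (hf : IsRV θ f)
    (hc : ∀ᶠ t in atTop, ContinuousAt f t) (hθ : -1 < θ) {f' : ℝ → ℝ}
    (hF : ∀ᶠ t in atTop, HasDerivAt F (f' t) t) (hle : ∀ᶠ t in atTop, f t ≤ f' t) :
    Tendsto F atTop atTop := by
  have h1 : Tendsto (fun t => f t * t ^ (1 : ℝ)) atTop atTop :=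
    (hf.mul (isRV_rpow 1) hc (eventually_continuousAt_rpow 1)).tendsto_atTop
      (hc.and (eventually_continuousAt_rpow 1) |>.mono fun t h => h.1.mul h.2) (by linarith)
  refine tendsto_atTop_of_deriv_le hF (h := fun t => t⁻¹) ?_ ?_ Real.tendsto_log_atTop
  · filter_upwards [eventually_gt_atTop 0] with t ht using Real.hasDerivAt_log ht.ne'
  · filter_upwards [eventually_gt_atTop 0, hle, h1.eventually_ge_atTop 1] with t h0 h2 h3
    rw [Real.rpow_one] at h3
    have : t⁻¹ ≤ f t := by rwa [inv_le_iff_one_le_mul₀ h0]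
    linarith

theorem IsRV.integrableOn_Ioi {θ : ℝ} {f : ℝ → ℝ} (hf : IsRV θ f)
    (hc : ∀ᶠ t in atTop, ContinuousAt f t) (hθ : θ < -1) {a : ℝ}
    (hloc : ContinuousOn f (Ici a)) : IntegrableOn f (Ioi a) := by
  obtain ⟨κ, hκ1, hκ2⟩ := exists_between hθ
  have h1 : Tendsto (fun t => f t * t ^ (-κ)) atTop (𝓝 0) :=
    (hf.mul (isRV_rpow (-κ)) hc (eventually_continuousAt_rpow _)).tendsto_zero
      (hc.and (eventually_continuousAt_rpow _) |>.mono fun t h => h.1.mul h.2) (by linarith)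
  have hO : f =O[atTop] fun t => t ^ κ := by
    refine Asymptotics.IsBigO.of_bound 1 ?_
    filter_upwards [h1.eventually_lt_const one_pos, hf.eventually_pos, eventually_gt_atTop 0]
      with t h2 h3 h4
    have h5 := Real.rpow_pos_of_pos h4 κ
    rw [Real.norm_eq_abs, Real.norm_eq_abs, abs_of_pos h3, abs_of_pos h5, one_mul]
    rw [Real.rpow_neg h4.le, ← div_eq_mul_inv, div_lt_one h5] at h2
    exact h2.le
  have hIci : IntegrableOn f (Ici a) := by
    refine (hloc.locallyIntegrableOn measurableSet_Ici).integrableOn_of_isBigO_atTop hO ?_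
    exact ⟨Ioi 1, Ioi_mem_atTop 1, integrableOn_Ioi_rpow_of_lt hκ2 one_pos⟩
  exact hIci.mono_set Ioi_subset_Ici_self

theorem isRV_tail {g : ℝ → ℝ} {a θ : ℝ} (hg : IsRV θ g) (hgc : ContinuousOn g (Ici a))
    (hint : IntegrableOn g (Ioi a)) : IsRV (θ + 1) (fun t => ∫ s in Ioi t, g s) := by
  have hF : ∀ᶠ t in atTop, HasDerivAt (fun t => ∫ s in Ioi t, g s) (-g t) t := by
    filter_upwards [eventually_gt_atTop a] with t ht using hasDerivAt_tail hgc hint ht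
  have h0 : Tendsto (fun t => ∫ s in Ioi t, g s) atTop (𝓝 0) :=
    tendsto_integral_Ioi_zero (f := g) (μ := volume) tendsto_id
  exact isRV_of_eventually (eventually_pos_of_deriv_neg hF hg.eventually_pos h0)
    (hF.mono fun t h => h.continuousAt) fun l hl => hg.tendsto_tail_ratio hF h0 hl

/-! ### Normalized slow variation -/

theorem mem_NSV_of_tendsto {y : ℝ → ℝ}
    (hy : ∀ᶠ t in atTop, 0 < y t ∧ HasDerivAt y (deriv y t) t ∧ ContinuousAt (deriv y) t)
    (hlim : Tendsto (fun t => t * deriv y t / y t) atTop (𝓝 0)) : y ∈ NSV := by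
  obtain ⟨T, hT⟩ := eventually_atTop.1 (hy.and (eventually_gt_atTop 0))
  have hyc : Continuous fun t => y (max t T) := continuous_iff_continuousAt.2 fun t =>
    ContinuousAt.comp (f := fun t => max t T) (hT _ (le_max_right _ _)).1.2.1.continuousAt
      (by fun_prop)
  have hψ : ∀ t, T ≤ t →
      EqOn (fun s => deriv y s / y s) (fun s => s * deriv y s / y (max s T) / s) (uIcc T t) := by
    intro t ht s hs
    rw [uIcc_of_le ht] at hs
    have hs0 := (hT s hs.1).2
    have hy0 := (hT s hs.1).1.1
    simp only [max_eq_left hs.1]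
    field_simp
  -- `max s T` makes the integrand measurable on the whole line.
  refine ⟨T, y T, fun s => s * deriv y s / y (max s T), (hT T le_rfl).2, (hT T le_rfl).1.1,
    (measurable_id.mul (measurable_deriv y)).div hyc.measurable, hlim.congr' ?_, fun t ht => ?_⟩
  · filter_upwards [eventually_ge_atTop T] with t ht
    rw [max_eq_left ht]
  have hint : IntervalIntegrable (fun s => deriv y s / y s) volume T t := by
    refine ContinuousOn.intervalIntegrable fun s hs => ?_
    rw [uIcc_of_le ht] at hs
    have h := (hT s hs.1).1
    exact (h.2.2.div h.2.1.continuousAt h.1.ne').continuousWithinAt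
  refine ⟨hint.congr ((hψ t ht).mono uIoc_subset_uIcc), ?_⟩
  rw [← intervalIntegral.integral_congr (hψ t ht),
    intervalIntegral.integral_eq_sub_of_hasDerivAt (f := fun s => Real.log (y s)) ?_ hint,
    Real.rpow_zero, mul_one, Real.exp_sub, Real.exp_log (hT t ht).1.1,
    Real.exp_log (hT T le_rfl).1.1, mul_div_cancel₀ _ (hT T le_rfl).1.1.ne']
  intro s hs
  rw [uIcc_of_le ht] at hs
  exact hasDerivAt_log_comp (hT s hs.1).1.1 (hT s hs.1).1.2.1

theorem NSV_subset_SV : NSV ⊆ SV := by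
  rintro f ⟨t₀, C, ψ, ht₀, hC, -, hψ, hf⟩
  have hf' : ∀ t, t₀ ≤ t → f t = C * Real.exp (∫ s in t₀..t, ψ s / s) := fun t ht => by
    rw [(hf t ht).2, Real.rpow_zero, mul_one]
  refine isRV_of_eventually ?_ ?_ fun l hl => ?_
  · filter_upwards [eventually_ge_atTop t₀] with t ht
    rw [hf' t ht]; positivity
  · filter_upwards [eventually_gt_atTop t₀] with t ht
    have hI : ContinuousAt (fun t => ∫ s in t₀..t, ψ s / s) t := by
      have hint := (hf (t + 1) (by linarith)).1
      have h1 : IntegrableOn (fun s => ψ s / s) (uIcc t₀ (t + 1)) := by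
        rw [uIcc_of_le (by linarith), integrableOn_Icc_iff_integrableOn_Ioc]
        exact (intervalIntegrable_iff_integrableOn_Ioc_of_le (by linarith)).1 hint
      have h2 := intervalIntegral.continuousOn_primitive_interval h1
      refine h2.continuousAt ?_
      rw [uIcc_of_le (by linarith)]
      exact Icc_mem_nhds ht (by linarith)
    refine ContinuousAt.congr (f := fun t => C * Real.exp (∫ s in t₀..t, ψ s / s))
      (continuousAt_const.mul hI.rexp) ?_
    filter_upwards [Ioi_mem_nhds ht] with s hs using (hf' s (le_of_lt hs)).symm
  · have hm : 0 < min 1 l := lt_min one_pos hl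
    have hdiff : Tendsto (fun t => ∫ s in t..l * t, ψ s / s) atTop (𝓝 0) := by
      rw [Metric.tendsto_atTop']
      intro ε hε
      have hA : 0 < |l - 1| / min 1 l + 1 := by positivity
      have h1 := (hψ.eventually (Metric.ball_mem_nhds 0 (div_pos hε hA)))
      obtain ⟨X, hX⟩ := eventually_atTop.1 h1
      obtain ⟨Y, hY⟩ := eventually_atTop.1 ((eventually_gt_atTop 0).and
        ((tendsto_const_mul_atTop_self hm).eventually_ge_atTop X))
      refine ⟨Y, fun t ht => ?_⟩
      obtain ⟨ht0, htX⟩ := hY t ht.le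
      have hb : ∀ s ∈ uIoc t (l * t), ‖ψ s / s‖ ≤ ε / (|l - 1| / min 1 l + 1) / (min 1 l * t) := by
        intro s hs
        have h2 : min 1 l * t ≤ s := by
          refine le_trans ?_ hs.1.le
          refine le_min ?_ (mul_le_mul_of_nonneg_right (min_le_right _ _) ht0.le)
          simpa using mul_le_mul_of_nonneg_right (min_le_left 1 l) ht0.le
        have h3 := hX s (htX.trans h2)
        rw [Real.dist_0_eq_abs] at h3
        have h4 : 0 < min 1 l * t := mul_pos hm ht0
        rw [norm_div, Real.norm_eq_abs, Real.norm_eq_abs, abs_of_pos (h4.trans_le h2)]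
        gcongr
      have h5 := intervalIntegral.norm_integral_le_of_norm_le_const hb
      rw [dist_zero_right]
      refine h5.trans_lt ?_
      rw [show l * t - t = (l - 1) * t by ring, abs_mul, abs_of_pos ht0]
      rw [show ε / (|l - 1| / min 1 l + 1) / (min 1 l * t) * (|l - 1| * t)
        = ε * ((|l - 1| / min 1 l) / (|l - 1| / min 1 l + 1)) by field_simp]
      have : |l - 1| / min 1 l / (|l - 1| / min 1 l + 1) < 1 := (div_lt_one hA).2 (by linarith)
      nlinarith
    have hexp := hdiff.rexp
    rw [Real.exp_zero, ← Real.rpow_zero l] at hexp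
    refine hexp.congr' ?_
    filter_upwards [eventually_ge_atTop t₀,
      (tendsto_const_mul_atTop_self hl).eventually_ge_atTop t₀] with t h1 h2
    rw [hf' _ h1, hf' _ h2, mul_div_mul_left _ _ hC.ne', ← Real.exp_sub,
      intervalIntegral.integral_interval_sub_left (hf _ h2).1 (hf _ h1).1]

/-! ### The odd power and the function `G` -/

theorem Phi_of_pos {α u : ℝ} (hu : 0 < u) : Phi α u = u ^ (α - 1) := by
  rw [Phi, abs_of_pos hu, Real.sign_of_pos hu, mul_one]

theorem Phi_pos_iff {α u : ℝ} : 0 < Phi α u ↔ 0 < u := by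
  rcases lt_trichotomy u 0 with hu | hu | hu
  · have := Real.rpow_pos_of_pos (abs_pos.2 hu.ne) (α - 1)
    simp only [Phi, Real.sign_of_neg hu, mul_neg, mul_one]
    constructor <;> intro h <;> linarith
  · simp [Phi, hu]
  · have := Real.rpow_pos_of_pos hu (α - 1)
    rw [Phi_of_pos hu]
    exact iff_of_true this hu

theorem conj_mul_eq_one {α β : ℝ} (hα : 1 < α) (hβ : 1 / α + 1 / β = 1) :
    (α - 1) * (β - 1) = 1 := by
  have hα0 : α ≠ 0 := by linarith
  have hβ0 : β ≠ 0 := by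
    rintro rfl
    rw [div_zero, add_zero, div_eq_one_iff_eq hα0] at hβ
    linarith
  field_simp at hβ
  linarith

theorem continuous_Phi {α : ℝ} (hα : 1 < α) : Continuous (Phi α) := by
  have hα1 : α - 1 ≠ 0 := by linarith
  have h : Phi α = fun u => max u 0 ^ (α - 1) - max (-u) 0 ^ (α - 1) := by
    funext u
    rcases lt_trichotomy u 0 with hu | hu | hu
    · rw [Phi, Real.sign_of_neg hu, abs_of_neg hu, max_eq_right hu.le, max_eq_left (by linarith),
        Real.zero_rpow hα1]
      ring
    · simp [Phi, hu]
    · rw [Phi_of_pos hu, max_eq_left hu.le, max_eq_right (by linarith), Real.zero_rpow hα1,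
        sub_zero]
  rw [h]
  have h0 : 0 ≤ α - 1 := by linarith
  exact ((continuous_id.max continuous_const).rpow_const fun _ => Or.inr h0).sub
    ((continuous_neg.max continuous_const).rpow_const fun _ => Or.inr h0)

theorem continuousOn_G {a β : ℝ} {r p : ℝ → ℝ} (hβ : 1 < β) (hr : ContinuousOn r (Ici a))
    (hr0 : ∀ t ∈ Ici a, 0 < r t) (hp : ContinuousOn p (Ici a)) : ContinuousOn (G β r p) (Ici a) :=
  (continuous_Phi hβ).comp_continuousOn
    ((continuousOn_id.mul hp).div hr fun t ht => (hr0 t ht).ne')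

theorem isRV_G {β δ γ : ℝ} {r p : ℝ → ℝ} (hp : IsRV δ p) (hr : IsRV γ r)
    (hpc : ∀ᶠ t in atTop, ContinuousAt p t) (hrc : ∀ᶠ t in atTop, ContinuousAt r t)
    (hGc : ∀ᶠ t in atTop, ContinuousAt (G β r p) t) :
    IsRV ((δ + 1 - γ) * (β - 1)) (G β r p) := by
  have hinvc : ∀ᶠ t in atTop, ContinuousAt (fun t => r t ^ (-1 : ℝ)) t := by
    filter_upwards [hrc, hr.eventually_pos] with t h1 h2 using h1.rpow_const (Or.inl h2.ne')
  have hpinvc : ∀ᶠ t in atTop, ContinuousAt (fun t => p t * r t ^ (-1 : ℝ)) t :=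
    hpc.and hinvc |>.mono fun t h => h.1.mul h.2
  have h1 := (isRV_rpow 1).mul (hp.mul (hr.rpow hrc (-1)) hpc hinvc)
    (eventually_continuousAt_rpow 1) hpinvc
  have h2 := h1.rpow ((eventually_continuousAt_rpow 1).and hpinvc |>.mono fun t h => h.1.mul h.2)
    (β - 1)
  rw [show δ + 1 - γ = 1 + (δ + γ * -1) by ring]
  refine h2.of_equivalent hGc (tendsto_const_nhds.congr' ?_)
  filter_upwards [hp.eventually_pos, hr.eventually_pos, eventually_gt_atTop 0] with t h3 h4 h5
  have hG : 0 < t * p t / r t := by positivity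
  rw [G, Phi_of_pos hG, Real.rpow_one, Real.rpow_neg_one, ← div_eq_mul_inv, mul_div_assoc]
  rw [mul_div_assoc] at hG
  rw [div_self (Real.rpow_pos_of_pos hG _).ne']

/-- For `γ = α + δ` the powers of `t` cancel, as `(α - 1)(β - 1) = 1`. -/
theorem mul_G_eq_slowPart {α β δ γ : ℝ} {r p : ℝ → ℝ} (hm : (α - 1) * (β - 1) = 1)
    (hγ : γ = α + δ) {t : ℝ} (ht : 0 < t) (hp : 0 < p t) (hr : 0 < r t) :
    slowPart δ p t ^ (β - 1) / slowPart γ r t ^ (β - 1) = t * G β r p t := by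
  have hδ0 := Real.rpow_pos_of_pos ht δ
  have hγ0 := Real.rpow_pos_of_pos ht γ
  have hα0 := Real.rpow_pos_of_pos ht (α - 1)
  rw [slowPart, slowPart, ← Real.div_rpow (by positivity) (by positivity), G,
    Phi_of_pos (by positivity)]
  have hpow : t ^ γ = t * t ^ (α - 1) * t ^ δ := by
    rw [hγ, Real.rpow_add ht, mul_comm t, ← Real.rpow_add_one ht.ne', sub_add_cancel]
  rw [show p t / t ^ δ / (r t / t ^ γ) = t ^ (α - 1) * (t * p t / r t) by rw [hpow]; field_simp,
    Real.mul_rpow hα0.le (by positivity), ← Real.rpow_mul ht.le, hm, Real.rpow_one]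

/-! ### Increasing solutions -/

/-- The condition `limsup t/τ(t) < ∞` in the form in which it is used. -/
theorem exists_const_mul_le_of_div_le {τ : ℝ → ℝ}
    (hτsup : ∃ M : ℝ, ∀ᶠ t in atTop, 0 < τ t ∧ t / τ t ≤ M) :
    ∃ c : ℝ, 0 < c ∧ ∀ᶠ t in atTop, c * t ≤ τ t := by
  obtain ⟨M, hM⟩ := hτsup
  refine ⟨(max M 1)⁻¹, by positivity, ?_⟩
  filter_upwards [hM] with t ht
  rw [inv_mul_le_iff₀ (by positivity)]
  exact ((div_le_iff₀ ht.1).1 ht.2).trans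
    (mul_le_mul_of_nonneg_right (le_max_left _ _) ht.1.le)

/-- Far from the left end of its half-line a solution is differentiable in the two-sided sense, and
the equation holds with `quasiDeriv`. -/
theorem eventually_regular_of_mem_Sol {a α : ℝ} {r p τ y : ℝ → ℝ} (hy : y ∈ Sol a α r p τ)
    (hτ : Tendsto τ atTop atTop) :
    ∀ᶠ t in atTop, (0 < y t ∧ HasDerivAt y (deriv y t) t ∧ ContinuousAt (deriv y) t) ∧
      HasDerivAt (quasiDeriv α r y) (p t * Phi α (y (τ t))) t := by
  obtain ⟨b, -, ⟨h1, h2, h3⟩, h0⟩ := hy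
  filter_upwards [eventually_gt_atTop b, hτ.eventually_ge_atTop b] with t ht htτ
  have hmem : Ici b ∈ 𝓝 t := Ici_mem_nhds ht
  refine ⟨⟨h0 t ht.le, ?_, ?_⟩, ?_⟩
  · exact ((h1.differentiableOn one_ne_zero).differentiableAt hmem).hasDerivAt
  · exact (((h1.mono Ioi_subset_Ici_self).continuousOn_deriv_of_isOpen isOpen_Ioi le_rfl)
      |>.continuousAt (Ioi_mem_nhds ht))
  · have hd := ((h2.differentiableOn one_ne_zero).differentiableAt hmem).hasDerivAt
    rw [← derivWithin_of_mem_nhds hmem, h3 t ht.le htτ] at hd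
    refine hd.congr_of_eventuallyEq ?_
    filter_upwards [Ioi_mem_nhds ht] with s hs
    rw [quasiDeriv, derivWithin_of_mem_nhds (Ici_mem_nhds hs)]

theorem exists_strictMonoOn_of_deriv_pos {y : ℝ → ℝ}
    (h : ∀ᶠ t in atTop, HasDerivAt y (deriv y t) t ∧ 0 < deriv y t) :
    ∃ T, StrictMonoOn y (Ici T) := by
  obtain ⟨T, hT⟩ := eventually_atTop.1 h
  exact ⟨T, strictMonoOn_of_deriv_pos (convex_Ici T)
    (fun t ht => (hT t ht).1.continuousAt.continuousWithinAt)
    fun t ht => (hT t (interior_subset ht)).2⟩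

theorem tendsto_quasiDeriv_atTop {a α : ℝ} {r p τ y P : ℝ → ℝ} (hα : 1 < α)
    (hy : y ∈ IncSol a α r p τ)
    (hτ : Tendsto τ atTop atTop) (hp : ∀ᶠ t in atTop, 0 < p t)
    (hP : ∀ᶠ t in atTop, HasDerivAt P (p t) t) (hPtop : Tendsto P atTop atTop) :
    Tendsto (quasiDeriv α r y) atTop atTop := by
  have hreg := eventually_regular_of_mem_Sol hy.1 hτ
  obtain ⟨T₀, hmono⟩ := exists_strictMonoOn_of_deriv_pos
    (hreg.and hy.2 |>.mono fun t h => ⟨h.1.1.2.1, h.2⟩)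
  obtain ⟨T, hT⟩ := eventually_atTop.1 (hreg.and (eventually_ge_atTop T₀))
  have hc : 0 < y T ^ (α - 1) := Real.rpow_pos_of_pos (hT T le_rfl).1.1.1 _
  refine tendsto_atTop_of_deriv_le (hreg.mono fun t h => h.2)
    (hP.mono fun t h => h.const_mul (y T ^ (α - 1))) ?_ (hPtop.const_mul_atTop hc)
  filter_upwards [hp, hτ.eventually_ge_atTop T] with t h1 h2
  have hyT := (hT T le_rfl).1.1.1
  have h3 : y T ≤ y (τ t) := hmono.monotoneOn (hT T le_rfl).2 (hT _ h2).2 h2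
  rw [Phi_of_pos (hyT.trans_le h3), mul_comm]
  have := Real.rpow_le_rpow hyT.le h3 (show 0 ≤ α - 1 by linarith)
  gcongr

/-- Increasing solutions satisfy `t y'/y → 0`. Here `P` is an antiderivative of `p`. -/
theorem tendsto_mul_deriv_div_of_mem_IncSol {a α : ℝ} {r p τ y P : ℝ → ℝ} (hα : 1 < α)
    (hy : y ∈ IncSol a α r p τ)
    (hτ : Tendsto τ atTop atTop) (hτle : ∀ᶠ t in atTop, τ t ≤ t)
    (hr : ∀ᶠ t in atTop, 0 < r t) (hp : ∀ᶠ t in atTop, 0 < p t)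
    (hP : ∀ᶠ t in atTop, HasDerivAt P (p t) t) (hPtop : Tendsto P atTop atTop)
    (hlim : Tendsto (fun t => t ^ (α - 1) / r t * P t) atTop (𝓝 0)) :
    Tendsto (fun t => t * deriv y t / y t) atTop (𝓝 0) := by
  have hα1 : 0 < α - 1 := by linarith
  have hreg := eventually_regular_of_mem_Sol hy.1 hτ
  obtain ⟨T₀, hmono⟩ := exists_strictMonoOn_of_deriv_pos
    (hreg.and hy.2 |>.mono fun t h => ⟨h.1.1.2.1, h.2⟩)
  obtain ⟨T, hT⟩ := eventually_atTop.1 (hreg.and ((hτ.eventually_ge_atTop T₀).and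
    ((eventually_ge_atTop T₀).and (hτle.and (hp.and (hP.and
      ((hτ.eventually hreg).mono fun t h => h.1.1)))))))
  -- On `[T, t]` the function `y^{[1]} - y(t)^(α-1) P` decreases.
  have hbound : ∀ t, T ≤ t → quasiDeriv α r y t - quasiDeriv α r y T ≤
      y t ^ (α - 1) * (P t - P T) := by
    intro t ht
    have hd : ∀ s, T ≤ s → HasDerivAt (fun s => quasiDeriv α r y s - y t ^ (α - 1) * P s)
        (p s * Phi α (y (τ s)) - y t ^ (α - 1) * p s) s := fun s hs =>
      (hT s hs).1.2.sub ((hT s hs).2.2.2.2.2.1.const_mul _)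
    have hanti : AntitoneOn (fun s => quasiDeriv α r y s - y t ^ (α - 1) * P s) (Icc T t) := by
      refine antitoneOn_of_deriv_nonpos (convex_Icc T t)
        (fun s hs => (hd s hs.1).continuousAt.continuousWithinAt)
        (fun s hs => (hd s (interior_subset hs).1).differentiableAt.differentiableWithinAt) ?_
      intro s hs
      obtain ⟨hs1, hs2⟩ := interior_subset hs
      obtain ⟨-, h1, -, h2, h3, -, h4⟩ := hT s hs1
      rw [(hd s hs1).deriv, Phi_of_pos h4]
      have h5 : y (τ s) ≤ y t := hmono.monotoneOn h1 (hT t ht).2.2.1 (h2.trans hs2)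
      have h6 := mul_le_mul_of_nonneg_left (Real.rpow_le_rpow h4.le h5 hα1.le) h3.le
      linarith
    have := hanti ⟨le_rfl, ht⟩ ⟨ht, le_rfl⟩ ht
    simp only at this
    linarith
  have hyT := (hT T le_rfl).1.1.1
  set C := |quasiDeriv α r y T| / y T ^ (α - 1) - P T with hC
  have hquot : Tendsto (fun t => t ^ (α - 1) / r t) atTop (𝓝 0) := by
    refine (hlim.div_atTop hPtop).congr' ?_
    filter_upwards [hPtop.eventually_gt_atTop 0] with t ht
    rw [mul_div_cancel_right₀ _ ht.ne']
  have hup : Tendsto (fun t => t ^ (α - 1) / r t * (C + P t)) atTop (𝓝 0) := by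
    have := (hquot.mul_const C).add hlim
    simpa only [mul_add, zero_mul, add_zero] using this
  have hpow : Tendsto (fun t => (t * deriv y t / y t) ^ (α - 1)) atTop (𝓝 0) := by
    refine squeeze_zero' ?_ ?_ hup
    · filter_upwards [hreg, hy.2, eventually_gt_atTop 0] with t h1 h2 h3
      have := h1.1.1
      positivity
    · filter_upwards [hreg, hy.2, eventually_gt_atTop 0, hr, eventually_ge_atTop T]
        with t h1 h2 h3 h4 h5
      have h0 := h1.1.1
      have hy0 : 0 < y t ^ (α - 1) := Real.rpow_pos_of_pos h0 _
      have hle : quasiDeriv α r y t / y t ^ (α - 1) ≤ C + P t := by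
        rw [div_le_iff₀ hy0, hC]
        have h6 := hbound t h5
        have h7 : y T ^ (α - 1) ≤ y t ^ (α - 1) := Real.rpow_le_rpow hyT.le
          (hmono.monotoneOn (hT T le_rfl).2.2.1 (hT t h5).2.2.1 h5) hα1.le
        have h8 : |quasiDeriv α r y T| ≤ |quasiDeriv α r y T| / y T ^ (α - 1) * y t ^ (α - 1) := by
          rw [div_mul_eq_mul_div, le_div_iff₀ (Real.rpow_pos_of_pos hyT _)]
          gcongr
        have h9 := le_abs_self (quasiDeriv α r y T)
        linarith
      calc (t * deriv y t / y t) ^ (α - 1)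
          = t ^ (α - 1) / r t * (quasiDeriv α r y t / y t ^ (α - 1)) := by
            rw [quasiDeriv, Phi_of_pos h2, Real.div_rpow (by positivity) h0.le,
              Real.mul_rpow h3.le h2.le]
            field_simp
        _ ≤ _ := by gcongr
  have hroot := hpow.rpow_const (p := (α - 1)⁻¹) (Or.inr (by positivity))
  rw [Real.zero_rpow (by positivity)] at hroot
  refine hroot.congr' ?_
  filter_upwards [hreg, hy.2, eventually_gt_atTop 0] with t h1 h2 h3
  have := h1.1.1
  exact Real.rpow_rpow_inv (by positivity) hα1.ne'

/-- A slowly varying solution increases: if it decreased, then `y^{[1]} ≤ 0`, whereas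
`(y^{[1]})' = p Φ(y(τ)) ≥ p y^(α-1)` forces `y^{[1]} → ∞`. -/
theorem mem_IncSol_of_mem_SV {a α δ : ℝ} {r p τ y : ℝ → ℝ} (hα : 1 < α) (hδ : -1 < δ)
    (hy : y ∈ Sol a α r p τ) (hySV : y ∈ SV)
    (hτ : Tendsto τ atTop atTop) (hτle : ∀ᶠ t in atTop, τ t ≤ t)
    (hr : ∀ᶠ t in atTop, 0 < r t) (hpRV : IsRV δ p)
    (hpc : ∀ᶠ t in atTop, ContinuousAt p t) : y ∈ IncSol a α r p τ := by
  have hreg := eventually_regular_of_mem_Sol hy hτ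
  have hp := hpRV.eventually_pos
  obtain ⟨T, hT⟩ := eventually_atTop.1 (hreg.and (hr.and (hp.and
    ((hτ.eventually hreg).mono fun t h => h.1.1))))
  have hmono : MonotoneOn (quasiDeriv α r y) (Ici T) := by
    refine monotoneOn_of_deriv_nonneg (convex_Ici T)
      (fun s hs => (hT s hs).1.2.continuousAt.continuousWithinAt)
      (fun s hs => (hT s (interior_subset hs)).1.2.differentiableAt.differentiableWithinAt) ?_
    intro s hs
    obtain ⟨h1, -, h2, h3⟩ := hT s (interior_subset hs)
    rw [h1.2.deriv]
    exact (mul_pos h2 (Phi_pos_iff.2 h3)).le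
  have hsign : ∀ t, T ≤ t → 0 < quasiDeriv α r y t → 0 < deriv y t := fun t ht h =>
    Phi_pos_iff.1 ((pos_iff_pos_of_mul_pos h).1 (hT t ht).2.1)
  by_cases hex : ∃ t₁, T ≤ t₁ ∧ 0 < quasiDeriv α r y t₁
  · obtain ⟨t₁, h1, h2⟩ := hex
    refine ⟨hy, ?_⟩
    filter_upwards [eventually_ge_atTop t₁] with t ht
    exact hsign t (h1.trans ht) (h2.trans_le (hmono h1 (h1.trans ht) ht))
  · exfalso
    push Not at hex
    have hanti : AntitoneOn y (Ici T) := by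
      refine antitoneOn_of_deriv_nonpos (convex_Ici T)
        (fun s hs => (hT s hs).1.1.2.1.continuousAt.continuousWithinAt)
        (fun s hs => (hT s (interior_subset hs)).1.1.2.1.differentiableAt.differentiableWithinAt) ?_
      intro s hs
      have hs' : T ≤ s := interior_subset hs
      by_contra! h
      exact (hex s hs').not_gt (mul_pos (hT s hs').2.1 (Phi_pos_iff.2 h))
    have hyc : ∀ᶠ t in atTop, ContinuousAt y t := hreg.mono fun t h => h.1.2.1.continuousAt
    have hpow : IsRV (0 * (α - 1)) (fun t => y t ^ (α - 1)) := IsRV.rpow hySV hyc _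
    have hpowc : ∀ᶠ t in atTop, ContinuousAt (fun t => y t ^ (α - 1)) t := by
      filter_upwards [hreg] with t h using h.1.2.1.continuousAt.rpow_const (Or.inl h.1.1.ne')
    have htop : Tendsto (quasiDeriv α r y) atTop atTop := by
      refine (hpRV.mul hpow hpc hpowc).antideriv_tendsto_atTop
        (hpc.and hpowc |>.mono fun t h => h.1.mul h.2) (by simpa using hδ)
        (hreg.mono fun t h => h.2) ?_
      filter_upwards [hτle, hτ.eventually_ge_atTop T, eventually_ge_atTop T, hp, hreg]
        with t h1 h2 h3 h4 h5
      have h6 : y t ≤ y (τ t) := hanti h2 h3 h1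
      have h7 := h5.1.1
      rw [Phi_of_pos (h7.trans_le h6)]
      have := Real.rpow_le_rpow h7.le h6 (show 0 ≤ α - 1 by linarith)
      gcongr
    obtain ⟨t, h1, h2⟩ := ((htop.eventually_gt_atTop 0).and (eventually_ge_atTop T)).exists
    exact (hex t h2).not_gt h1

/-- A delay comparable with `t` does not change an increasing slowly varying function
asymptotically. -/
theorem tendsto_comp_delay_div {τ y : ℝ → ℝ} (hySV : y ∈ SV) (hmono : ∃ T, StrictMonoOn y (Ici T))
    (hτle : ∀ᶠ t in atTop, τ t ≤ t) {c : ℝ} (hc : 0 < c) (hcτ : ∀ᶠ t in atTop, c * t ≤ τ t) :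
    Tendsto (fun t => y (τ t) / y t) atTop (𝓝 1) := by
  obtain ⟨T, hT⟩ := hmono
  have h1 := hySV.2 c hc
  rw [Real.rpow_zero] at h1
  have hctop := (tendsto_const_mul_atTop_self hc).eventually_ge_atTop T
  refine tendsto_of_tendsto_of_tendsto_of_le_of_le' h1 tendsto_const_nhds ?_ ?_
  · filter_upwards [hctop, hcτ, IsRV.eventually_pos hySV] with t h2 h3 h4
    have := hT.monotoneOn h2 (h2.trans h3) h3
    gcongr
  · filter_upwards [hctop, hcτ, hτle, eventually_ge_atTop T, IsRV.eventually_pos hySV]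
      with t h2 h3 h5 h6 h4
    rw [div_le_one h4]
    exact hT.monotoneOn (h2.trans h3) h6 h5

/-- The asymptotic relation `y'/y ∼ G / Φ⁻¹(δ + 1)`, from Karamata's theorem for `y^{[1]}`. -/
theorem tendsto_logDeriv_div_G {a α β δ : ℝ} {r p τ y : ℝ → ℝ} (hα : 1 < α)
    (hβ : 1 / α + 1 / β = 1) (hδ : -1 < δ) (hy : y ∈ IncSol a α r p τ) (hySV : y ∈ SV)
    (hτ : Tendsto τ atTop atTop) (hτle : ∀ᶠ t in atTop, τ t ≤ t)
    (hτc : ∀ᶠ t in atTop, ContinuousAt τ t) {c : ℝ} (hc : 0 < c)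
    (hcτ : ∀ᶠ t in atTop, c * t ≤ τ t)
    (hr : ∀ᶠ t in atTop, 0 < r t) (hpRV : IsRV δ p)
    (hpc : ∀ᶠ t in atTop, ContinuousAt p t)
    (htop : Tendsto (quasiDeriv α r y) atTop atTop) :
    Tendsto (fun t => (deriv y t / y t) / (G β r p t / Phi β (δ + 1))) atTop (𝓝 1) := by
  have hα1 : 0 < α - 1 := by linarith
  have hreg := eventually_regular_of_mem_Sol hy.1 hτ
  have hmono := exists_strictMonoOn_of_deriv_pos
    (hreg.and hy.2 |>.mono fun t h => ⟨h.1.1.2.1, h.2⟩)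
  have hp := hpRV.eventually_pos
  have hquot := tendsto_comp_delay_div hySV hmono hτle hc hcτ
  have hyc : ∀ᶠ t in atTop, ContinuousAt y t := hreg.mono fun t h => h.1.2.1.continuousAt
  have hyτc : ∀ᶠ t in atTop, ContinuousAt (fun t => y (τ t)) t := by
    filter_upwards [hτ.eventually hyc, hτc] with t h1 h2
    exact ContinuousAt.comp (f := τ) h1 h2
  have hyτpos : ∀ᶠ t in atTop, 0 < y (τ t) := hτ.eventually (IsRV.eventually_pos hySV)
  have hyτ : IsRV 0 (fun t => y (τ t)) := IsRV.of_equivalent hySV hyτc hquot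
  have hφc : ∀ᶠ t in atTop, ContinuousAt (fun t => y (τ t) ^ (α - 1)) t := by
    filter_upwards [hyτc, hyτpos] with t h1 h2 using h1.rpow_const (Or.inl h2.ne')
  have hf : IsRV δ (fun t => p t * y (τ t) ^ (α - 1)) := by
    simpa using hpRV.mul (hyτ.rpow hyτc (α - 1)) hpc hφc
  have hK := hf.tendsto_mul_div_antideriv
    (hpc.and hφc |>.mono fun t h => h.1.mul h.2) hδ (F := quasiDeriv α r y) (by
      filter_upwards [hreg, hyτpos] with t h1 h2
      rw [← Phi_of_pos h2]
      exact h1.2) htop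
  -- This is `t p y^(α-1) / y^{[1]} → δ + 1`.
  have hK2 := hK.div (hquot.rpow_const (p := α - 1) (Or.inl one_ne_zero)) (by simp)
  rw [Real.one_rpow, div_one] at hK2
  have hm : (α - 1) * (β - 1) = 1 := conj_mul_eq_one hα hβ
  have hδ1 : 0 < δ + 1 := by linarith
  have hΦ : 0 < (δ + 1) ^ (β - 1) := Real.rpow_pos_of_pos hδ1 _
  have hK3 := ((hK2.rpow_const (p := β - 1) (Or.inl hδ1.ne')).inv₀ hΦ.ne').const_mul
    ((δ + 1) ^ (β - 1))
  rw [mul_inv_cancel₀ hΦ.ne'] at hK3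
  refine hK3.congr' ?_
  filter_upwards [hreg, hy.2, hp, hr, hyτpos, eventually_gt_atTop 0] with t h1 h2 h3 h4 h5 h6
  have hy0 := h1.1.1
  have hG : 0 < t * p t / r t := by positivity
  have hkey : (t * (p t * y (τ t) ^ (α - 1)) / quasiDeriv α r y t / (y (τ t) / y t) ^ (α - 1))
      = (t * p t / r t) * (y t / deriv y t) ^ (α - 1) := by
    have := Real.rpow_pos_of_pos h5 (α - 1)
    have := Real.rpow_pos_of_pos h2 (α - 1)
    have := Real.rpow_pos_of_pos hy0 (α - 1)
    rw [quasiDeriv, Phi_of_pos h2, Real.div_rpow h5.le hy0.le, Real.div_rpow hy0.le h2.le]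
    field_simp
  simp only [Pi.div_apply]
  rw [hkey, Real.mul_rpow hG.le (by positivity), ← Real.rpow_mul (by positivity), hm,
    Real.rpow_one, G, Phi_of_pos hG, Phi_of_pos hδ1]
  have := Real.rpow_pos_of_pos hG (β - 1)
  field_simp

/-! ### Integration of the logarithmic derivative -/

/-- If `y'/y ∼ g`, then `y` is the exponential of the integral of a function `(1 + ε) g`. The values
of `ε` near the left end are free and are used to adjust the constant of integration. -/
theorem exists_eq_exp_integral {y g : ℝ → ℝ} (a : ℝ)
    (hy : ∀ᶠ t in atTop, 0 < y t ∧ HasDerivAt y (deriv y t) t ∧ ContinuousAt (deriv y) t)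
    (hg : ∀ᶠ t in atTop, 0 < g t)
    (hlim : Tendsto (fun t => (deriv y t / y t) / g t) atTop (𝓝 1)) :
    ∃ ε : ℝ → ℝ, Tendsto ε atTop (𝓝 0) ∧
      (∀ t ∈ Ici a, IntervalIntegrable (fun s => (1 + ε s) * g s) volume a t) ∧
      ∀ᶠ t in atTop, y t = Real.exp (∫ s in a..t, (1 + ε s) * g s) := by
  obtain ⟨T, hT⟩ := eventually_atTop.1 (hy.and (hg.and (eventually_ge_atTop a)))
  -- `w` is to be the integrand: its integral from `a` to `T + 1` is `log (y (T + 1))`. It vanishes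
  -- up to `T`, since `g` may have zeros there, where `w / g` would be the junk value `0`.
  let w : ℝ → ℝ := fun s =>
    if s ≤ T then 0 else if s ≤ T + 1 then Real.log (y (T + 1)) else deriv y s / y s
  have hw : (fun s => (1 + (w s / g s - 1)) * g s) = w := by
    funext s
    rw [add_sub_cancel]
    by_cases hs : s ≤ T
    · simp [w, hs]
    · exact div_mul_cancel₀ _ (hT s (le_of_not_ge hs)).2.1.ne'
  have hTT : T ≤ T + 1 := by linarith
  have e1 : EqOn (fun _ => 0) w (uIoc a T) := by
    intro s hs
    rw [uIoc_of_le (hT T le_rfl).2.2] at hs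
    simp [w, hs.2]
  have e2 : EqOn (fun _ => Real.log (y (T + 1))) w (uIoc T (T + 1)) := by
    intro s hs
    rw [uIoc_of_le hTT] at hs
    simp [w, hs.2, hs.1]
  have e3 : ∀ t, T + 1 ≤ t → EqOn (fun s => deriv y s / y s) w (uIoc (T + 1) t) := by
    intro t ht s hs
    rw [uIoc_of_le ht] at hs
    simp [w, not_le.2 hs.1, not_le.2 (hTT.trans_lt hs.1)]
  have hint : ∀ t, T + 1 ≤ t →
      IntervalIntegrable (fun s => deriv y s / y s) volume (T + 1) t := by
    intro t ht
    refine ContinuousOn.intervalIntegrable fun s hs => ?_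
    rw [uIcc_of_le ht] at hs
    have h := (hT s (hTT.trans hs.1)).1
    exact (h.2.2.div h.2.1.continuousAt h.1.ne').continuousWithinAt
  have i1 : IntervalIntegrable w volume a T :=
    (intervalIntegrable_const (μ := volume) (c := (0 : ℝ))).congr e1
  have i2 : IntervalIntegrable w volume T (T + 1) :=
    (intervalIntegrable_const (μ := volume) (c := Real.log (y (T + 1)))).congr e2
  have i3 : ∀ t, T + 1 ≤ t → IntervalIntegrable w volume (T + 1) t := fun t ht =>
    (hint t ht).congr (e3 t ht)
  have hcongr : ∀ {u : ℝ → ℝ} {c d : ℝ}, EqOn u w (uIoc c d) →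
      ∫ s in c..d, u s = ∫ s in c..d, w s := fun h =>
    intervalIntegral.integral_congr_ae (Eventually.of_forall h)
  refine ⟨fun s => w s / g s - 1, ?_, fun t ht => ?_, ?_⟩
  · have := hlim.sub_const 1
    rw [sub_self] at this
    refine this.congr' ?_
    filter_upwards [eventually_gt_atTop (T + 1)] with t ht
    simp [w, not_le.2 ht, not_le.2 (hTT.trans_lt ht)]
  · rw [hw]
    refine ((i1.trans i2).trans (i3 (max t (T + 1)) (le_max_right _ _))).mono_set ?_
    rw [uIcc_of_le ht, uIcc_of_le (le_trans ht (le_max_left _ _))]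
    exact Icc_subset_Icc_right (le_max_left _ _)
  · filter_upwards [eventually_ge_atTop (T + 1)] with t ht
    have hFTC := intervalIntegral.integral_eq_sub_of_hasDerivAt
      (f := fun s => Real.log (y s)) (fun s hs => ?_) (hint t ht)
    · rw [hw, ← intervalIntegral.integral_add_adjacent_intervals (i1.trans i2) (i3 t ht),
        ← intervalIntegral.integral_add_adjacent_intervals i1 i2,
        ← hcongr e1, ← hcongr e2,
        ← hcongr (e3 t ht), hFTC,
        intervalIntegral.integral_zero, intervalIntegral.integral_const]
      simp only [add_sub_cancel_left, one_smul, zero_add, add_sub_cancel]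
      rw [Real.exp_log (hT t (hTT.trans ht)).1.1]
    · rw [uIcc_of_le ht] at hs
      have h := (hT s (hTT.trans hs.1)).1
      exact hasDerivAt_log_comp h.1 h.2.1

/-- If `y'/y ∼ g` with `g` integrable near `∞`, then `y` has a positive limit, and `log y` differs
from the limit of `log y` by a tail integral of some `(1 + ε) g`. -/
theorem exists_eq_mul_exp_tail {y g : ℝ → ℝ} {a : ℝ}
    (hy : ∀ᶠ t in atTop, 0 < y t ∧ HasDerivAt y (deriv y t) t ∧ ContinuousAt (deriv y) t)
    (hy' : ∀ᶠ t in atTop, 0 < deriv y t)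
    (hg : ∀ᶠ t in atTop, 0 < g t) (hint : IntegrableOn g (Ioi a))
    (hlim : Tendsto (fun t => (deriv y t / y t) / g t) atTop (𝓝 1)) :
    ∃ N : ℝ, 0 < N ∧ Tendsto y atTop (𝓝 N) ∧
      ∃ ε : ℝ → ℝ, Tendsto ε atTop (𝓝 0) ∧
        ∀ᶠ t in atTop, IntegrableOn (fun s => (1 + ε s) * g s) (Ioi t) ∧
          y t = N * Real.exp (-∫ s in Ioi t, (1 + ε s) * g s) := by
  obtain ⟨T, hT⟩ := eventually_atTop.1 (hy.and (hg.and ((eventually_ge_atTop a).and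
    ((hlim.eventually_lt_const one_lt_two).and hy'))))
  have hlogint : IntegrableOn (fun s => deriv y s / y s) (Ioi T) := by
    refine Integrable.mono' ((hint.mono_set (Ioi_subset_Ioi (hT T le_rfl).2.2.1)).const_mul 2) ?_ ?_
    · refine ContinuousOn.aestronglyMeasurable (fun s hs => ?_) measurableSet_Ioi
      have h := (hT s (le_of_lt hs)).1
      exact (h.2.2.div h.2.1.continuousAt h.1.ne').continuousWithinAt
    · refine (ae_restrict_iff' measurableSet_Ioi).2 (Eventually.of_forall fun s hs => ?_)
      obtain ⟨h1, h2, -, h3, h4⟩ := hT s (le_of_lt hs)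
      rw [Real.norm_eq_abs, abs_of_pos (div_pos h4 h1.1)]
      exact ((div_lt_iff₀ h2).1 h3).le
  have hder : ∀ s, T ≤ s → HasDerivAt (fun s => Real.log (y s)) (deriv y s / y s) s :=
    fun s hs => hasDerivAt_log_comp (hT s hs).1.1 (hT s hs).1.2.1
  obtain ⟨m, hm⟩ : ∃ m, Tendsto (fun s => Real.log (y s)) atTop (𝓝 m) :=
    ⟨_, tendsto_limUnder_of_hasDerivAt_of_integrableOn_Ioi
      (fun s hs => hder s (le_of_lt hs)) hlogint⟩
  refine ⟨Real.exp m, Real.exp_pos m, hm.rexp.congr' ?_, fun s => deriv y s / y s / g s - 1, ?_, ?_⟩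
  · filter_upwards [hy] with t ht using Real.exp_log ht.1
  · simpa using hlim.sub_const 1
  · filter_upwards [eventually_ge_atTop T] with t ht
    have heq : EqOn (fun s => deriv y s / y s)
        (fun s => (1 + (deriv y s / y s / g s - 1)) * g s) (Ioi t) := fun s hs => by
      simp only
      rw [add_sub_cancel, div_mul_cancel₀ _ (hT s (ht.trans (le_of_lt hs))).2.1.ne']
    have hintt : IntegrableOn (fun s => deriv y s / y s) (Ioi t) :=
      hlogint.mono_set (Ioi_subset_Ioi ht)
    refine ⟨hintt.congr_fun heq measurableSet_Ioi, ?_⟩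
    rw [← setIntegral_congr_fun measurableSet_Ioi heq,
      integral_Ioi_of_hasDerivAt_of_tendsto' (fun s hs => hder s (ht.trans hs)) hintt hm,
      neg_sub, Real.exp_sub, Real.exp_log (hT t ht).1.1, mul_div_cancel₀ _ (Real.exp_pos m).ne']

theorem tendsto_sub_div_tail {y g : ℝ → ℝ} {a N : ℝ} (hN : 0 < N)
    (hy : ∀ᶠ t in atTop, 0 < y t ∧ HasDerivAt y (deriv y t) t)
    (hyN : Tendsto y atTop (𝓝 N)) (hgc : ContinuousOn g (Ici a))
    (hg : ∀ᶠ t in atTop, 0 < g t) (hint : IntegrableOn g (Ioi a)) {c : ℝ} (hc : 0 < c)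
    (hlim : Tendsto (fun t => (deriv y t / y t) / (g t / c)) atTop (𝓝 1)) :
    Tendsto (fun t => (N - y t) / (N / c * ∫ s in Ioi t, g s)) atTop (𝓝 1) := by
  have hNc : 0 < N / c := div_pos hN hc
  refine HasDerivAt.lhopital_zero_atTop (f' := fun t => - deriv y t)
    (g' := fun t => N / c * (-g t)) (hy.mono fun t h => h.2.const_sub N) ?_ ?_ ?_ ?_ ?_
  · filter_upwards [eventually_gt_atTop a] with t ht
    exact (hasDerivAt_tail hgc hint ht).const_mul _
  · filter_upwards [hg] with t ht
    exact (mul_neg_of_pos_of_neg hNc (neg_neg_of_pos ht)).ne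
  · simpa using hyN.const_sub N
  · simpa using (tendsto_integral_Ioi_zero (f := g) (μ := volume) tendsto_id).const_mul (N / c)
  · have h1 := hlim.mul (hyN.div_const N)
    rw [div_self hN.ne', one_mul] at h1
    refine h1.congr' ?_
    filter_upwards [hg, hy] with t h2 h3
    have := h3.1
    field_simp

end HalfLinear

theorem theorem3p1 (a α β : ℝ) (r p τ : ℝ → ℝ)
    (hα : 1 < α) (hβ : 1 / α + 1 / β = 1)
    (hr : ContinuousOn r (Ici a)) (hr0 : ∀ t ∈ Ici a, 0 < r t)
    (hp : ContinuousOn p (Ici a)) (hp0 : ∀ t ∈ Ici a, 0 < p t)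
    (hτ : ContDiffOn ℝ 1 τ (Ici a)) (hτ' : ∀ t ∈ Ici a, 0 < derivWithin τ (Ici a) t)
    (hτle : ∀ t ∈ Ici a, τ t ≤ t)
    (hτsup : ∃ M : ℝ, ∀ᶠ t in atTop, 0 < τ t ∧ t / τ t ≤ M)
    (hpint : Tendsto (fun t => ∫ s in a..t, p s) atTop atTop)
    (hlim : Tendsto (fun t => t ^ (α - 1) / r t * ∫ s in a..t, p s) atTop (𝓝 0)) :
    -- increasing solutions are normalized slowly varying
    IncSol a α r p τ ⊆ NSV ∧
    ∀ δ : ℝ, -1 < δ → IsRV δ p →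
      -- the case where the integral of `G` diverges
      (Tendsto (fun t => ∫ s in a..t, G β r p s) atTop atTop →
        (∀ y ∈ IncSol a α r p τ, ∃ ε : ℝ → ℝ, Tendsto ε atTop (𝓝 0) ∧
          (∀ t ∈ Ici a,
            IntervalIntegrable (fun s => (1 + ε s) * (G β r p s / Phi β (δ + 1))) volume a t) ∧
          ∀ᶠ t in atTop,
            y t = Real.exp (∫ s in a..t, (1 + ε s) * (G β r p s / Phi β (δ + 1)))) ∧
        Sol a α r p τ ∩ NSV = Sol a α r p τ ∩ SV ∧
        Sol a α r p τ ∩ SV = IncSol a α r p τ ∧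
        IncSol a α r p τ = IncSolLim a α r p τ .inf .inf) ∧
      -- the case where the integral of `G` converges
      (IntegrableOn (G β r p) (Ioi a) →
        (∀ y ∈ IncSol a α r p τ, ∃ N : ℝ, 0 < N ∧ Tendsto y atTop (𝓝 N) ∧
          ∃ ε : ℝ → ℝ, Tendsto ε atTop (𝓝 0) ∧
            ∀ᶠ t in atTop,
              IntegrableOn (fun s => (1 + ε s) * (G β r p s / Phi β (δ + 1))) (Ioi t) ∧
              y t = N * Real.exp (-∫ s in Ioi t, (1 + ε s) * (G β r p s / Phi β (δ + 1)))) ∧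
        Sol a α r p τ ∩ NSV = Sol a α r p τ ∩ SV ∧
        Sol a α r p τ ∩ SV = IncSol a α r p τ ∧
        IncSol a α r p τ = IncSolLim a α r p τ .B .inf) ∧
      -- the case where `r` is regularly varying as well
      ∀ γ : ℝ, IsRV γ r →
        α + δ ≤ γ ∧
        (γ = α + δ → ∀ y ∈ IncSol a α r p τ, InPi y (fun t => t * deriv y t)) ∧
        ((γ = α + δ ∧ IntegrableOn (G β r p) (Ioi a)) ∨ α + δ < γ →
          IntegrableOn (G β r p) (Ioi a) ∧
          ∀ y ∈ IncSol a α r p τ, ∃ N : ℝ, 0 < N ∧ Tendsto y atTop (𝓝 N) ∧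
            Tendsto (fun t => (N - y t) / (N / Phi β (δ + 1) * ∫ s in Ioi t, G β r p s))
              atTop (𝓝 1) ∧
            IsRV ((δ + 1 - γ) * (β - 1) + 1)
              (fun t => N / Phi β (δ + 1) * ∫ s in Ioi t, G β r p s) ∧
            (γ = α + δ →
              IsRV 0 (fun t => |N - y t|) ∧
              Tendsto (fun t => slowPart δ p t ^ (β - 1) /
                (slowPart γ r t ^ (β - 1) * (N - y t))) atTop (𝓝 0))) := by
  have hα1 : 0 < α - 1 := by linarith
  have hm : (α - 1) * (β - 1) = 1 := conj_mul_eq_one hα hβ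
  have hβ1 : 0 < β - 1 := by
    by_contra! h
    nlinarith
  obtain ⟨c, hc, hcτ⟩ := exists_const_mul_le_of_div_le hτsup
  have hτtop : Tendsto τ atTop atTop :=
    tendsto_atTop_mono' atTop hcτ (tendsto_const_mul_atTop_self hc)
  have hgt := eventually_gt_atTop a
  have hr' : ∀ᶠ t in atTop, 0 < r t := hgt.mono fun t h => hr0 t h.le
  have hp' : ∀ᶠ t in atTop, 0 < p t := hgt.mono fun t h => hp0 t h.le
  have hrc : ∀ᶠ t in atTop, ContinuousAt r t :=
    hgt.mono fun t h => hr.continuousAt (Ici_mem_nhds h)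
  have hpc : ∀ᶠ t in atTop, ContinuousAt p t :=
    hgt.mono fun t h => hp.continuousAt (Ici_mem_nhds h)
  have hτc : ∀ᶠ t in atTop, ContinuousAt τ t :=
    hgt.mono fun t h => hτ.continuousOn.continuousAt (Ici_mem_nhds h)
  have hτle' : ∀ᶠ t in atTop, τ t ≤ t := hgt.mono fun t h => hτle t h.le
  have hP : ∀ᶠ t in atTop, HasDerivAt (fun t => ∫ s in a..t, p s) (p t) t :=
    hgt.mono fun t h => hasDerivAt_primitive hp h
  have hGc : ContinuousOn (G β r p) (Ici a) := continuousOn_G (by linarith) hr hr0 hp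
  have hGc' : ∀ᶠ t in atTop, ContinuousAt (G β r p) t :=
    hgt.mono fun t h => hGc.continuousAt (Ici_mem_nhds h)
  have hG0 : ∀ᶠ t in atTop, 0 < G β r p t := by
    filter_upwards [hr', hp', eventually_gt_atTop 0] with t h1 h2 h3
    exact Phi_pos_iff.2 (by positivity)
  have hreg : ∀ y ∈ IncSol a α r p τ, ∀ᶠ t in atTop,
      0 < y t ∧ HasDerivAt y (deriv y t) t ∧ ContinuousAt (deriv y) t := fun y hy =>
    (eventually_regular_of_mem_Sol hy.1 hτtop).mono fun t h => h.1
  have hNSV : IncSol a α r p τ ⊆ NSV := fun y hy => mem_NSV_of_tendsto (hreg y hy)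
    (tendsto_mul_deriv_div_of_mem_IncSol hα hy hτtop hτle' hr' hp' hP hpint hlim)
  have hqtop : ∀ y ∈ IncSol a α r p τ, Tendsto (quasiDeriv α r y) atTop atTop := fun y hy =>
    tendsto_quasiDeriv_atTop hα hy hτtop hp' hP hpint
  refine ⟨hNSV, fun δ hδ hpRV => ?_⟩
  have hc0 : 0 < Phi β (δ + 1) := Phi_pos_iff.2 (by linarith)
  have hlogG : ∀ y ∈ IncSol a α r p τ,
      Tendsto (fun t => (deriv y t / y t) / (G β r p t / Phi β (δ + 1))) atTop (𝓝 1) :=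
    fun y hy => tendsto_logDeriv_div_G hα hβ hδ hy (NSV_subset_SV (hNSV hy)) hτtop hτle' hτc hc
      hcτ hr' hpRV hpc (hqtop y hy)
  have hG0' : ∀ᶠ t in atTop, 0 < G β r p t / Phi β (δ + 1) := hG0.mono fun t h => div_pos h hc0
  have hSV : Sol a α r p τ ∩ SV = IncSol a α r p τ := Subset.antisymm
    (fun y hy => mem_IncSol_of_mem_SV hα hδ hy.1 hy.2 hτtop hτle' hr' hpRV hpc)
    fun y hy => ⟨hy.1, NSV_subset_SV (hNSV hy)⟩
  have hSVN : Sol a α r p τ ∩ NSV = Sol a α r p τ ∩ SV := Subset.antisymm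
    (inter_subset_inter_right _ NSV_subset_SV)
    fun y hy => ⟨hy.1, hNSV (hSV ▸ hy : y ∈ IncSol a α r p τ)⟩
  have hconv : IntegrableOn (G β r p) (Ioi a) → ∀ y ∈ IncSol a α r p τ,
      ∃ N : ℝ, 0 < N ∧ Tendsto y atTop (𝓝 N) ∧ ∃ ε : ℝ → ℝ, Tendsto ε atTop (𝓝 0) ∧
        ∀ᶠ t in atTop,
          IntegrableOn (fun s => (1 + ε s) * (G β r p s / Phi β (δ + 1))) (Ioi t) ∧
          y t = N * Real.exp (-∫ s in Ioi t, (1 + ε s) * (G β r p s / Phi β (δ + 1))) :=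
    fun hint y hy =>
      exists_eq_mul_exp_tail (hreg y hy) hy.2 hG0' (hint.div_const _) (hlogG y hy)
  refine ⟨fun hdiv => ⟨fun y hy => exists_eq_exp_integral a (hreg y hy) hG0' (hlogG y hy), hSVN,
    hSV, Subset.antisymm (fun y hy => ⟨hy, ?_, hqtop y hy⟩) fun y hy => hy.1⟩,
    fun hint => ⟨hconv hint, hSVN, hSV,
      Subset.antisymm (fun y hy => ?_) fun y hy => hy.1⟩, fun γ hrRV => ?_⟩
  · -- The derivative of `log y` eventually exceeds `G / (2 Φ⁻¹(δ + 1))`.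
    have hlogtop : Tendsto (fun t => Real.log (y t)) atTop atTop := by
      refine tendsto_atTop_of_deriv_le (h := fun t => (2 * Phi β (δ + 1))⁻¹ * G β r p t)
        ((hreg y hy).mono fun t h => hasDerivAt_log_comp h.1 h.2.1)
        (hgt.mono fun t h => (hasDerivAt_primitive hGc h).const_mul _) ?_
        (hdiv.const_mul_atTop (by positivity))
      filter_upwards [(hlogG y hy).eventually_const_lt one_half_lt_one, hG0'] with t h1 h2
      refine le_trans (le_of_eq ?_) ((lt_div_iff₀ h2).1 h1).le
      field_simp
    refine (Real.tendsto_exp_atTop.comp hlogtop).congr' ?_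
    filter_upwards [hreg y hy] with t h using Real.exp_log h.1
  · obtain ⟨N, hN, hyN, -⟩ := hconv hint y hy
    exact ⟨hy, ⟨N, hN.ne', hyN⟩, hqtop y hy⟩
  have hGRV := isRV_G (β := β) hpRV hrRV hpc hrc hGc'
  have hexp : γ = α + δ → (δ + 1 - γ) * (β - 1) = -1 := fun h => by
    rw [h, show δ + 1 - (α + δ) = -(α - 1) by ring, neg_mul, hm]
  have hy'RV : γ = α + δ → ∀ y ∈ IncSol a α r p τ, IsRV (-1) (deriv y) := by
    intro hγ y hy
    have hyc : ∀ᶠ t in atTop, ContinuousAt y t := (hreg y hy).mono fun t h => h.2.1.continuousAt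
    have h1 := (IsRV.mul (NSV_subset_SV (hNSV hy)) hGRV hyc hGc').const_mul
      (hyc.and hGc' |>.mono fun t h => h.1.mul h.2) (inv_pos.2 hc0)
    rw [hexp hγ, zero_add] at h1
    refine h1.of_equivalent ((hreg y hy).mono fun t h => h.2.2) ((hlogG y hy).congr' ?_)
    filter_upwards [hreg y hy, hG0] with t h2 h3
    have := h2.1
    field_simp
  refine ⟨?_, fun hγ y hy => ?_, fun hcase => ?_⟩
  · -- Otherwise `t^(α-1) r⁻¹ ∫ p` would be regularly varying with a positive index.
    by_contra! hlt
    have hPc := hP.mono fun t h => h.continuousAt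
    have hPRV : IsRV (δ + 1) (fun t => ∫ s in a..t, p s) :=
      isRV_of_eventually (hpint.eventually_gt_atTop 0) hPc
        fun l hl => hpRV.tendsto_antideriv_ratio hP hpint hl
    have hinvc : ∀ᶠ t in atTop, ContinuousAt (fun t => r t ^ (-1 : ℝ)) t := by
      filter_upwards [hrc, hr'] with t h1 h2 using h1.rpow_const (Or.inl h2.ne')
    have hqc := (eventually_continuousAt_rpow (α - 1)).and hinvc |>.mono
      fun t h => h.1.mul h.2
    have h1 := (((isRV_rpow (α - 1)).mul (hrRV.rpow hrc (-1))
      (eventually_continuousAt_rpow _) hinvc).mul hPRV hqc hPc).tendsto_atTop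
        (hqc.and hPc |>.mono fun t h => h.1.mul h.2) (by linarith)
    simp only [Real.rpow_neg_one, ← div_eq_mul_inv] at h1
    exact not_tendsto_nhds_of_tendsto_atTop h1 _ hlim
  · obtain ⟨b, hb⟩ := eventually_atTop.1 (hreg y hy)
    refine ⟨⟨b, Continuous.measurable (continuousOn_iff_continuous_domRestrict.1
      fun t ht => (hb t ht).2.1.continuousAt.continuousWithinAt)⟩, ?_, fun l hl => ?_⟩
    · filter_upwards [hy.2, eventually_gt_atTop 0] with t h1 h2 using mul_pos h2 h1
    · have h1 := (hy'RV hγ y hy).tendsto_increment ((hreg y hy).mono fun t h => h.2.2)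
        ((hreg y hy).mono fun t h => h.2.1) hl
      simp only [Real.rpow_neg_one] at h1
      rwa [integral_inv_of_pos one_pos hl, div_one] at h1
  · have hint : IntegrableOn (G β r p) (Ioi a) := by
      rcases hcase with h | h
      · exact h.2
      · refine hGRV.integrableOn_Ioi hGc' ?_ hGc
        nlinarith
    refine ⟨hint, fun y hy => ?_⟩
    obtain ⟨N, hN, hyN, -⟩ := hconv hint y hy
    have htail := tendsto_sub_div_tail hN ((hreg y hy).mono fun t h => ⟨h.1, h.2.1⟩) hyN hGc hG0
      hint hc0 (hlogG y hy)
    have htailc : ∀ᶠ t in atTop, ContinuousAt (fun t => ∫ s in Ioi t, G β r p s) t :=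
      hgt.mono fun t h => (hasDerivAt_tail hGc hint h).continuousAt
    refine ⟨N, hN, hyN, htail, (isRV_tail hGRV hGc hint).const_mul htailc (div_pos hN hc0),
      fun hγ => ?_⟩
    have hD : ∀ᶠ t in atTop, HasDerivAt (fun t => N - y t) (-deriv y t) t :=
      (hreg y hy).mono fun t h => h.2.1.const_sub N
    have hD0 : Tendsto (fun t => N - y t) atTop (𝓝 0) := by simpa using hyN.const_sub N
    have hDpos := eventually_pos_of_deriv_neg hD hy.2 hD0
    have hRV' := hy'RV hγ y hy
    constructor
    · refine isRV_of_eventually (hDpos.mono fun t h => abs_pos.2 h.ne')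
        (hD.mono fun t h => h.continuousAt.abs) fun l hl => ?_
      have h1 := hRV'.tendsto_tail_ratio hD hD0 hl
      rw [neg_add_cancel] at h1
      refine h1.congr' ?_
      filter_upwards [hDpos, (tendsto_const_mul_atTop_self hl).eventually hDpos] with t h2 h3
      rw [abs_of_pos h2, abs_of_pos h3]
    · have h1 := hRV'.tendsto_mul_div_tail ((hreg y hy).mono fun t h => h.2.2) hD hD0 hDpos
      have h2 := (h1.mul ((hyN.inv₀ hN.ne').const_mul (Phi β (δ + 1)))).div (hlogG y hy) one_ne_zero
      rw [zero_mul, zero_div] at h2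
      refine h2.congr' ?_
      filter_upwards [hreg y hy, hG0, hDpos, eventually_gt_atTop 0, hr', hp', hy.2]
        with t h3 h4 h5 h6 h7 h8 h9
      have := h3.1
      simp only [Pi.div_apply]
      rw [← div_div, mul_G_eq_slowPart hm hγ h6 h8 h7]
      field_simp
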